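/- **Setting.** A biquandle is a set $X$ with two binary operations $\underline{*},\overline{*}$ such that: (1) $x\,\underline{*}\,x=x\,\overline{*}\,x$; (2) the maps $\bullet\,\underline{*}\,y$, $\bullet\,\overline{*}\,y$ on $X$ and $(x,y)\mapsto(y\,\overline{*}\,x,\;x\,\underline{*}\,y)$ on $X\times X$ are bijective; (3) $(x\underline{*}y)\underline{*}(z\underline{*}y)=(x\underline{*}z)\underline{*}(y\overline{*}z)$, $(x\overline{*}y)\overline{*}(z\overline{*}y)=(x\overline{*}z)\overline{*}(y\underline{*}z)$, $(x\underline{*}y)\overline{*}(z\underline{*}y)=(x\overline{*}z)\underline{*}(y\overline{*}z)$. Let $\overline{*}^{-1}$ denote the inverse operation, $(x\,\overline{*}\,y)\,\overline{*}^{-1}y=x$. The derived quandle $Q(X)$ is the set $X$ with $x*y=(x\,\underline{*}\,y)\,\overline{*}^{-1}y$. Let $D$ be a diagram of an oriented classical link, drawn in general position with respect to the height function and cut by horizontal lines into strips each containing exactly one crossing, maximum or minimum (every diagram is planar isotopic to such a one). Normal vectors of strings point to the left of the direction of travel; the specified region of a semi-arc is the one from which its normal vector points. At a crossing let $\sigma_i,\sigma_k$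 be the under and $\sigma_j,\sigma_l$ the over semi-arcs, $\sigma_i,\sigma_j$ being those adjacent to the region from which both normals point away. An $X$-coloring of $D$ is a map $C$ from semi-arcs to $X$ with $C(\sigma_i)\,\underline{*}\,C(\sigma_j)=C(\sigma_k)$ and $C(\sigma_j)\,\overline{*}\,C(\sigma_i)=C(\sigma_l)$ at every crossing. A $Q(X)$-coloring is a map $C$ from arcs to $Q(X)$ with $C(\sigma_i)*C(\sigma_j)=C(\sigma_k)$ at every crossing (evaluated on the arcs containing these semi-arcs). **Theorem.** For every biquandle $X$ and every diagram $D$ as above there are mutually inverse maps $\Psi$ from the $Q(X)$-colorings of $D$ to the $X$-colorings of $D$ and $\Phi$ in the other direction, with the following descriptions. (a) *Double, pull away, restrict.* Let $W(D)$ be the doubled diagram: $D$ together with a copy of $D$ of opposite orientation and opposite crossings, placed behind $D$ and pushed slightly in the normal direction. Let $D\sqcup -D^h$ be $D$ with, on its right, its mirror image in a vertical line with opposite orientation. For each $Q(X)$-coloring $C$ of $D$ there is exactly one $X$-coloring $C_1$ of $W(D)$ such that on each of the horizontal lines both strings of each parallel pair have the color given by $C$. On each line, move the leftmost copy string to the right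 end, under all other strings, then the second copy string to the left of the first, and so on, the colors changing by the biquandle coloring condition. There is exactly one $X$-coloring $C_2$ of $D\sqcup -D^h$ with the resulting colors on all these lines, and $\Psi(C)$ is the restriction of $C_2$ to $D$. (b) *Push out to the unbounded region.* Let $C$ be an $X$-coloring of $D$ and $\sigma$ a semi-arc. There is an arc $\gamma$ from the unbounded region to $\sigma$, missing crossings, transverse to $D$ and reaching $\sigma$ from its specified region; and for every such $\gamma$, pushing $\sigma$ out along $\gamma$ over all the strings that $\gamma$ crosses gives the head of the pushed-out semi-arc the well-defined color $\Phi(C)(\alpha)$, where $\alpha$ is the arc containing $\sigma$. (c) *Algebraic description of $\Psi$.* Let $\mathrm{As}(Q(X))=\langle x\in X\mid x\cdot y=y\cdot(x*y)\rangle$ and let $k:X\to X$ be the unique bijection with $k(x)\,\overline{*}\,k(x)=x$. There is exactly one map $\psi:\mathrm{As}(Q(X))\times Q(X)\to X$ with $\psi(e,a)=a$, $\psi(p\cdot b,a)=\psi(p,a)\,\overline{*}\,\psi(p,b)$ and $\psi(p\cdot b^{-1},a)=\psi(p,a)\,\overline{*}^{-1}k(\psi(p,b))$. For each $Q(X)$-coloring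 $C$ of $D$ there is exactly one map $C^R$ from the regions of $D$ to $\mathrm{As}(Q(X))$ which is $e$ on the unbounded region and satisfies $C^R(R_1)\cdot C(\sigma)=C^R(R_2)$ whenever the normal vector of a semi-arc $\sigma$ points from $R_1$ to $R_2$. With the shadow coloring $C^S(\sigma)=(C^R(\rho_\sigma),C(\sigma))$, where $\rho_\sigma$ is the specified region of $\sigma$, one has $\Psi(C)=\psi\circ C^S$. -/

import Mathlib

/-!  Biquandles and their derived quandles. -/

/-- A biquandle: `underOp x y` is the operation `x` under-star `y`,
`overOp x y` is the operation `x` over-star `y`. -/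
class Biquandle (X : Type*) where
  underOp : X → X → X
  overOp : X → X → X
  under_self : ∀ x, underOp x x = overOp x x
  under_bijective : ∀ y, Function.Bijective (fun x => underOp x y)
  over_bijective : ∀ y, Function.Bijective (fun x => overOp x y)
  switch_bijective : Function.Bijective (fun p : X × X => (overOp p.2 p.1, underOp p.1 p.2))
  under_under : ∀ x y z,
    underOp (underOp x y) (underOp z y) = underOp (underOp x z) (overOp y z)
  over_over : ∀ x y z,
    overOp (overOp x y) (overOp z y) = overOp (overOp x z) (underOp y z)
  under_over : ∀ x y z,
    overOp (underOp x y) (underOp z y) = underOp (overOp x z) (overOp y z)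

namespace Biquandle

variable {X : Type*} [Biquandle X]

/-- The inverse operation: `overInv x y` is the unique `z` with `overOp z y = x`. -/
noncomputable def overInv (x y : X) : X :=
  (Equiv.ofBijective _ (over_bijective (X := X) y)).symm x

/-- The inverse operation: `underInv x y` is the unique `z` with `underOp z y = x`. -/
noncomputable def underInv (x y : X) : X :=
  (Equiv.ofBijective _ (under_bijective (X := X) y)).symm x

theorem over_overInv (x y : X) : overOp (overInv x y) y = x :=
  (Equiv.ofBijective _ (over_bijective (X := X) y)).apply_symm_apply x

theorem overInv_over (x y : X) : overInv (overOp x y) y = x :=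
  (Equiv.ofBijective _ (over_bijective (X := X) y)).symm_apply_apply x

theorem under_underInv (x y : X) : underOp (underInv x y) y = x :=
  (Equiv.ofBijective _ (under_bijective (X := X) y)).apply_symm_apply x

theorem underInv_under (x y : X) : underInv (underOp x y) y = x :=
  (Equiv.ofBijective _ (under_bijective (X := X) y)).symm_apply_apply x

theorem over_cancel {x x' : X} (y : X) (h : overOp x y = overOp x' y) : x = x' :=
  (over_bijective y).1 h

theorem over_self_bijective : Function.Bijective (fun x : X => overOp x x) := by
  constructor
  · intro x y h
    have h' : overOp x x = overOp y y := h
    have := (switch_bijective (X := X)).1 (a₁ := (x, x)) (a₂ := (y, y))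
      (by simp [under_self, h'])
    exact congrArg Prod.fst this
  · intro a
    obtain ⟨⟨x, y⟩, h⟩ := (switch_bijective (X := X)).2 (a, a)
    have h1 : overOp y x = a := congrArg Prod.fst h
    have h2 : underOp x y = a := congrArg Prod.snd h
    have h3 := under_under x y x
    rw [h1, h2] at h3
    exact ⟨x, (under_self x).symm.trans ((under_bijective a).1 h3).symm⟩

/-- The unique bijection `k` with `overOp (k x) (k x) = x`. -/
noncomputable def k : X → X :=
  (Equiv.ofBijective _ (over_self_bijective (X := X))).symm

theorem over_k_k (x : X) : overOp (k x) (k x) = x :=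
  (Equiv.ofBijective _ (over_self_bijective (X := X))).apply_symm_apply x

/-- The derived operation `x * y`, namely `underOp x y` followed by the inverse of `overOp _ y`. -/
noncomputable def star (x y : X) : X := overInv (underOp x y) y

theorem over_star (x y : X) : overOp (star x y) y = underOp x y := over_overInv _ _

theorem star_over (x y z : X) : overOp (star x y) z = star (overOp x z) (overOp y z) := by
  apply over_cancel (overOp y z)
  rw [over_star, over_over, over_star, under_over]

theorem star_star (x y z : X) : star (star x y) z = star (star x z) (star y z) := by
  apply over_cancel z
  rw [over_star, star_over (star x z), over_star, over_star]
  apply over_cancel (underOp y z)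
  rw [over_star, under_over, over_star, under_under]

theorem star_self (x : X) : star x x = x := by
  apply over_cancel x
  rw [over_star, under_self]

end Biquandle

/-- The underlying set of the derived quandle of `X` is that of `X`. -/
def DerivedQuandle (X : Type*) : Type _ := X

namespace DerivedQuandle

/-- The identity map, forgetting the derived structure. -/
def toBase {X : Type*} (a : DerivedQuandle X) : X := a

/-- The identity map to the derived quandle. -/
def ofBase {X : Type*} (a : X) : DerivedQuandle X := a

/-- The derived quandle.  In Mathlib a quandle acts on itself from the left; the right
operation `a * b` is written `Shelf.act b a`. -/
noncomputable instance {X : Type*} [Biquandle X] : Quandle (DerivedQuandle X) where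
  act y x := ofBase (Biquandle.star (toBase x) (toBase y))
  self_distrib := fun {x y z} => Biquandle.star_star (X := X) z y x
  invAct y x := ofBase (Biquandle.underInv (Biquandle.overOp (toBase x) (toBase y)) (toBase y))
  left_inv y x := (congrArg (fun t : X => Biquandle.underInv t y)
    (Biquandle.over_star (X := X) x y)).trans (Biquandle.underInv_under (X := X) x y)
  right_inv y x := (congrArg (fun t : X => Biquandle.overInv t y)
    (Biquandle.under_underInv (X := X) (Biquandle.overOp (X := X) x y) y)).trans
      (Biquandle.overInv_over (X := X) x y)
  fix := fun {x} => Biquandle.star_self (X := X) x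

end DerivedQuandle

/-- The associated group of a quandle: generated by the elements of `Q` with the relations
`x * y = y * (x ∗ y)`, where `x ∗ y` is the right quandle operation. -/
abbrev AssocGroup (Q : Type*) [Quandle Q] : Type _ :=
  PresentedGroup {w : FreeGroup Q | ∃ x y : Q,
    w = (FreeGroup.of x * FreeGroup.of y) *
      (FreeGroup.of y * FreeGroup.of (Shelf.act y x))⁻¹}

/-- The generator of the associated group given by an element of the quandle. -/
def AssocGroup.of {Q : Type*} [Quandle Q] (a : Q) : AssocGroup Q := PresentedGroup.of a

/-- The recursive equations for the map `ψ` from pairs (group element, quandle element) to `X`. -/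
structure IsPsi {X : Type*} [Biquandle X]
    (ψ : AssocGroup (DerivedQuandle X) → DerivedQuandle X → X) : Prop where
  one : ∀ a, ψ 1 a = a.toBase
  mul : ∀ p a b, ψ (p * AssocGroup.of b) a = Biquandle.overOp (ψ p a) (ψ p b)
  mul_inv : ∀ p a b,
    ψ (p * (AssocGroup.of b)⁻¹) a = Biquandle.overInv (ψ p a) (Biquandle.k (ψ p b))

/-!  Oriented link diagrams.

A diagram is drawn in the plane in general position with respect to the height function and cut
by horizontal lines into strips, each containing one maximum, one minimum or one crossing and
otherwise only vertical strings.  Every oriented link diagram is planar isotopic to such a one.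
A horizontal line meets the diagram in a finite row of strings, recorded from left to right by
their orientations: `true` is downward, `false` is upward. -/

/-- One strip, with `l` and `r` the orientations of the vertical strings to the left and right.
* `birth l r d`: a local maximum, whose left leg is downward iff `d = true`;
* `death l r d`: a local minimum, whose left leg is downward iff `d = true`;
* `cross l r a b o`: a crossing of the string from top left to bottom right (orientation `a`)
  with the string from top right to bottom left (orientation `b`); the former is the over string
  iff `o = true`. -/
inductive Slice
  | birth (l r : List Bool) (d : Bool)
  | death (l r : List Bool) (d : Bool)
  | cross (l r : List Bool) (a b o : Bool)

namespace Slice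

/-- The row of strings on the upper boundary of the strip. -/
def top : Slice → List Bool
  | birth l r _ => l ++ r
  | death l r d => l ++ d :: (!d) :: r
  | cross l r a b _ => l ++ a :: b :: r

/-- The row of strings on the lower boundary of the strip. -/
def bot : Slice → List Bool
  | birth l r d => l ++ d :: (!d) :: r
  | death l r _ => l ++ r
  | cross l r a b _ => l ++ b :: a :: r

/-- Boundary points of a strip that are ends of one string in it not taking part in a crossing.
Here `Sum.inl i` is the `i`-th point of the upper boundary and `Sum.inr i` that of the lower
boundary, counted from `0`. -/
inductive Joins : Slice → ℕ ⊕ ℕ → ℕ ⊕ ℕ → Prop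
  | birth_left (l r d i) : i < l.length → Joins (birth l r d) (.inl i) (.inr i)
  | birth_right (l r d i) : l.length ≤ i → Joins (birth l r d) (.inl i) (.inr (i + 2))
  | birth_arch (l r d) : Joins (birth l r d) (.inr l.length) (.inr (l.length + 1))
  | death_left (l r d i) : i < l.length → Joins (death l r d) (.inl i) (.inr i)
  | death_right (l r d i) : l.length ≤ i → Joins (death l r d) (.inl (i + 2)) (.inr i)
  | death_arch (l r d) : Joins (death l r d) (.inl l.length) (.inl (l.length + 1))
  | cross_left (l r a b o i) : i < l.length → Joins (cross l r a b o) (.inl i) (.inr i)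
  | cross_right (l r a b o i) : l.length + 2 ≤ i → Joins (cross l r a b o) (.inl i) (.inr i)

/-- The two ends of the over string of a crossing. -/
inductive OverJoins : Slice → ℕ ⊕ ℕ → ℕ ⊕ ℕ → Prop
  | left (l r a b) : OverJoins (cross l r a b true) (.inl l.length) (.inr (l.length + 1))
  | right (l r a b) : OverJoins (cross l r a b false) (.inl (l.length + 1)) (.inr l.length)

/-- Gaps on the boundary of a strip that bound the same region of the strip.  The `i`-th gap is
the one with exactly `i` strings to its left. -/
inductive JoinsGaps : Slice → ℕ ⊕ ℕ → ℕ ⊕ ℕ → Prop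
  | birth_left (l r d i) : i ≤ l.length → JoinsGaps (birth l r d) (.inl i) (.inr i)
  | birth_right (l r d i) : l.length ≤ i → JoinsGaps (birth l r d) (.inl i) (.inr (i + 2))
  | death_left (l r d i) : i ≤ l.length → JoinsGaps (death l r d) (.inl i) (.inr i)
  | death_right (l r d i) : l.length ≤ i → JoinsGaps (death l r d) (.inl (i + 2)) (.inr i)
  | cross_left (l r a b o i) : i ≤ l.length → JoinsGaps (cross l r a b o) (.inl i) (.inr i)
  | cross_right (l r a b o i) : l.length + 2 ≤ i →
      JoinsGaps (cross l r a b o) (.inl i) (.inr i)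

end Slice

/-- The strips `L`, stacked from top to bottom, match along their boundaries, starting with the
row `u` and ending with the row `v`. -/
def IsTangle : List Bool → List Slice → List Bool → Prop
  | u, [], v => u = v
  | u, s :: L, v => s.top = u ∧ IsTangle s.bot L v

/-- A diagram of an oriented link. -/
structure LinkDiagram where
  slices : List Slice
  isTangle : IsTangle [] slices []

/-- The four ends at a crossing: `i` and `k` are the two halves of the under string, `j` and `l`
those of the over string, where `i` and `j` are the halves that bound the specified region of the
crossing, the one from which both normal vectors point away. -/
structure Quad (α : Type*) where
  i : α
  j : α
  k : α
  l : α

/-- The four ends at a crossing with orientations `a`, `b` and crossing information `o` as for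
`Slice.cross`.  Normal vectors point to the left of the direction of travel (a downward string has
its normal vector pointing to the right of the page), so the specified region of the crossing is
the one lying on the right-hand side of both strings. -/
def Quad.ofEnds {α : Type*} (a b o : Bool) (tl tr bl br : α) : Quad α :=
  let nearA := if b then tl else br
  let farA := if b then br else tl
  let nearB := if a then bl else tr
  let farB := if a then tr else bl
  if o then ⟨nearB, nearA, farB, farA⟩ else ⟨nearA, nearB, farA, farB⟩

/-- The biquandle coloring condition at one crossing. -/
def Quad.IsBiquandleColored {X : Type*} [Biquandle X] (q : Quad X) : Prop :=
  Biquandle.underOp q.i q.j = q.k ∧ Biquandle.overOp q.j q.i = q.l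

namespace LinkDiagram

variable (D : LinkDiagram)

/-- The row of strings met by the `j`-th horizontal line, which is the upper boundary of the
`j`-th strip. -/
def row (j : ℕ) : List Bool :=
  match D.slices[j]? with
  | some s => s.top
  | none => []

/-- The intersection points of the diagram with the horizontal lines: `(j, i)` is the `i`-th
point on the `j`-th line. -/
def Point : Type := {p : ℕ × ℕ // p.2 < (D.row p.1).length}

/-- The gaps between the strings on the horizontal lines. -/
def Gap : Type := {g : ℕ × ℕ // g.1 ≤ D.slices.length ∧ g.2 ≤ (D.row g.1).length}

/-- Position in the diagram of a place on the boundary of the `j`-th strip. -/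
def place (j : ℕ) : ℕ ⊕ ℕ → ℕ × ℕ
  | .inl i => (j, i)
  | .inr i => (j + 1, i)

/-- Two points connected within one strip, away from crossings. -/
def Joined (p q : D.Point) : Prop :=
  ∃ j s e f, D.slices[j]? = some s ∧ s.Joins e f ∧ p.1 = place j e ∧ q.1 = place j f

/-- Two points connected through the over string of a crossing. -/
def OverJoined (p q : D.Point) : Prop :=
  ∃ j s e f, D.slices[j]? = some s ∧ s.OverJoins e f ∧ p.1 = place j e ∧ q.1 = place j f

/-- Two gaps connected within one strip, in the complement of the diagram. -/
def GapJoined (g h : D.Gap) : Prop :=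
  ∃ j s e f, D.slices[j]? = some s ∧ s.JoinsGaps e f ∧ g.1 = place j e ∧ h.1 = place j f

/-- The set of semi-arcs. -/
def SemiArc : Type := Quot D.Joined

/-- The set of arcs. -/
def Arc : Type := Quot fun p q => D.Joined p q ∨ D.OverJoined p q

/-- The set of regions, the connected components of the complement of the diagram. -/
def Region : Type := Quot D.GapJoined

/-- The semi-arc through a point. -/
def semiArc (p : D.Point) : D.SemiArc := Quot.mk _ p

/-- The natural surjection from semi-arcs to arcs. -/
def proj : D.SemiArc → D.Arc := Quot.map id fun _ _ h => Or.inl h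

/-- The arc through a point. -/
def arc (p : D.Point) : D.Arc := D.proj (D.semiArc p)

/-- The unbounded region. -/
def unbounded : D.Region := Quot.mk _ ⟨(0, 0), Nat.zero_le _, Nat.zero_le _⟩

theorem level_le {j i : ℕ} (h : i < (D.row j).length) : j ≤ D.slices.length := by
  by_contra hj
  have : D.slices[j]? = none := List.getElem?_eq_none (by omega)
  simp [row, this] at h

/-- The region on the left side (on the page) of a point. -/
def leftRegion (p : D.Point) : D.Region :=
  Quot.mk _ ⟨p.1, D.level_le p.2, p.2.le⟩

/-- The region on the right side (on the page) of a point. -/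
def rightRegion (p : D.Point) : D.Region :=
  Quot.mk _ ⟨(p.1.1, p.1.2 + 1), D.level_le p.2, p.2⟩

/-- The orientation of the string through a point. -/
def down (p : D.Point) : Bool := (D.row p.1.1)[p.1.2]'p.2

/-- The specified region at a point of a semi-arc: the one from which its normal vector points. -/
def specified (p : D.Point) : D.Region :=
  if D.down p then D.leftRegion p else D.rightRegion p

/-- The region to which the normal vector at a point of a semi-arc points. -/
def opposite (p : D.Point) : D.Region :=
  if D.down p then D.rightRegion p else D.leftRegion p

/-- The four points of the diagram around some crossing. -/
def IsCrossing (q : Quad D.Point) : Prop :=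
  ∃ (j : ℕ) (l r : List Bool) (a b o : Bool) (tl tr bl br : D.Point),
    D.slices[j]? = some (.cross l r a b o) ∧
    tl.1 = (j, l.length) ∧ tr.1 = (j, l.length + 1) ∧
    bl.1 = (j + 1, l.length) ∧ br.1 = (j + 1, l.length + 1) ∧
    q = Quad.ofEnds a b o tl tr bl br

/-- Quandle colorings of a diagram. -/
structure QuandleColoring (Q : Type*) [Quandle Q] where
  toFun : D.Arc → Q
  crossing : ∀ q, D.IsCrossing q →
    Shelf.act (toFun (D.arc q.j)) (toFun (D.arc q.i)) = toFun (D.arc q.k)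

/-- Biquandle colorings of a diagram. -/
structure BiquandleColoring (X : Type*) [Biquandle X] where
  toFun : D.SemiArc → X
  crossing : ∀ q, D.IsCrossing q →
    Quad.IsBiquandleColored ⟨toFun (D.semiArc q.i), toFun (D.semiArc q.j),
      toFun (D.semiArc q.k), toFun (D.semiArc q.l)⟩

/-- Given values at the points, the row of orientations and values along the `j`-th line. -/
def coloredRow {X : Type*} (c : D.Point → X) (j : ℕ) : List (Bool × X) :=
  List.ofFn fun i : Fin (D.row j).length => ((D.row j)[i], c ⟨(j, i), i.2⟩)

variable {D}

/-- The row of orientations and colors along the `j`-th line. -/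
def QuandleColoring.row {Q : Type*} [Quandle Q] (C : D.QuandleColoring Q) (j : ℕ) :
    List (Bool × Q) :=
  D.coloredRow (fun p => C.toFun (D.arc p)) j

/-- The row of orientations and colors along the `j`-th line. -/
def BiquandleColoring.row {X : Type*} [Biquandle X] (C : D.BiquandleColoring X) (j : ℕ) :
    List (Bool × X) :=
  D.coloredRow (fun p => C.toFun (D.semiArc p)) j

/-- `R` is the region coloring with respect to the quandle coloring `C`. -/
structure IsRegionColoring {Q : Type*} [Quandle Q] (C : D.QuandleColoring Q)
    (R : D.Region → AssocGroup Q) : Prop where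
  unbounded : R D.unbounded = 1
  cross : ∀ p : D.Point,
    R (D.specified p) * AssocGroup.of (C.toFun (D.arc p)) = R (D.opposite p)

end LinkDiagram

/-!  The doubled diagram and the disjoint union with the reversed mirror image. -/

theorem IsTangle.append : ∀ {u v w : List Bool} {L M : List Slice},
    IsTangle u L v → IsTangle v M w → IsTangle u (L ++ M) w
  | _, _, _, [], _, h, h' => by
    have h : _ = _ := h
    subst h
    exact h'
  | _, _, _, _ :: _, _, h, h' => ⟨h.1, IsTangle.append h.2 h'⟩

/-- The row of the doubled diagram.  Each string is replaced by itself and its parallel copy,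
pushed in the normal direction and with the opposite orientation: a downward string has its copy
on its right, an upward one on its left, so that each pair reads downward, upward. -/
def doubleRow (u : List Bool) : List Bool := u.flatMap fun _ => [true, false]

/-- For each string of the doubled row, whether it belongs to the original (front) diagram. -/
def frontTags (u : List Bool) : List Bool := u.flatMap fun d => [d, !d]

/-- Crossing information in the doubled diagram, for the strings from top left and from top right,
`f` and `g` telling whether they belong to the original diagram: the original is in front of the
copy, originals cross as before (`o`) and copies cross in the opposite way. -/
def doubleOver (o f g : Bool) : Bool :=
  if f then (if g then o else true) else (if g then false else !o)

/-- The doubled diagram of a strip. -/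
def Slice.double : Slice → List Slice
  | birth l r _ =>
    [birth (doubleRow l) (doubleRow r) true,
     birth (doubleRow l ++ [true]) (false :: doubleRow r) false]
  | death l r _ =>
    [death (doubleRow l ++ [true]) (false :: doubleRow r) false,
     death (doubleRow l) (doubleRow r) true]
  | cross l r a b o =>
    [cross (doubleRow l ++ [true]) (false :: doubleRow r) false true (doubleOver o (!a) b),
     cross (doubleRow l) (false :: false :: doubleRow r) true true (doubleOver o a b),
     cross (doubleRow l ++ [true, true]) (doubleRow r) false false (doubleOver o (!a) (!b)),
     cross (doubleRow l ++ [true]) (false :: doubleRow r) true false (doubleOver o a (!b))]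

theorem Slice.double_isTangle (s : Slice) :
    IsTangle (doubleRow s.top) s.double (doubleRow s.bot) := by
  cases s <;> simp [IsTangle, Slice.double, Slice.top, Slice.bot, doubleRow]

theorem IsTangle.double : ∀ {u v : List Bool} {L : List Slice}, IsTangle u L v →
    IsTangle (doubleRow u) (L.flatMap Slice.double) (doubleRow v)
  | _, _, [], h => congrArg doubleRow h
  | _, _, s :: _, h => by
    rw [List.flatMap_cons]
    exact h.1 ▸ IsTangle.append s.double_isTangle (IsTangle.double h.2)

/-- The row of the mirror image in a vertical line, with the opposite orientation. -/
def mirrorRow (u : List Bool) : List Bool := (u.map not).reverse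

/-- The mirror image of a strip in a vertical line with the opposite orientation, to the right of
the vertical strings `u`. -/
def Slice.mirror (u : List Bool) : Slice → Slice
  | birth l r d => birth (u ++ mirrorRow r) (mirrorRow l) d
  | death l r d => death (u ++ mirrorRow r) (mirrorRow l) d
  | cross l r a b o => cross (u ++ mirrorRow r) (mirrorRow l) (!b) (!a) (!o)

/-- A strip, to the left of the vertical strings `u`. -/
def Slice.addRight (u : List Bool) : Slice → Slice
  | birth l r d => birth l (r ++ u) d
  | death l r d => death l (r ++ u) d
  | cross l r a b o => cross l (r ++ u) a b o

/-- A strip next to its mirror image with the opposite orientation; the strip is passed first. -/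
def Slice.besideMirror (s : Slice) : List Slice :=
  [s.addRight (mirrorRow s.top), s.mirror s.bot]

theorem Slice.besideMirror_isTangle (s : Slice) :
    IsTangle (s.top ++ mirrorRow s.top) s.besideMirror (s.bot ++ mirrorRow s.bot) := by
  cases s <;> simp [IsTangle, besideMirror, addRight, mirror, top, bot, mirrorRow]

theorem IsTangle.besideMirror : ∀ {u v : List Bool} {L : List Slice}, IsTangle u L v →
    IsTangle (u ++ mirrorRow u) (L.flatMap Slice.besideMirror) (v ++ mirrorRow v)
  | _, _, [], h => congrArg (fun u => u ++ mirrorRow u) h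
  | _, _, s :: _, h => by
    rw [List.flatMap_cons]
    exact h.1 ▸ IsTangle.append s.besideMirror_isTangle (IsTangle.besideMirror h.2)

/-- A string with a color, `front` telling whether it belongs to the front part. -/
structure Strand (X : Type*) where
  front : Bool
  down : Bool
  color : X

/-- `Slide d x u u' y`: a string with orientation `d` and color `x` at the top moves to the right,
passing under all strings of the row `u` one after the other; at the bottom the row has become
`u'` and the moving string, now at the right end, has the color `y`. -/
inductive Slide {X : Type*} [Biquandle X] (d : Bool) :
    X → List (Strand X) → List (Strand X) → X → Prop
  | nil (x) : Slide d x [] [] x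
  | cons (x x' y : X) (t : Strand X) (c : X) (u u' : List (Strand X)) :
      (Quad.ofEnds d t.down false x t.color c x').IsBiquandleColored →
      Slide d x' u u' y → Slide d x (t :: u) (⟨t.front, t.down, c⟩ :: u') y

/-- `PullAway u F B`: in the colored row `u` the leftmost back string is moved to the right end,
then the second back string to the left of the first, and so on, always passing under the other
strings; the result is the row `F` of front strings followed by the row `B` of back strings. -/
inductive PullAway {X : Type*} [Biquandle X] :
    List (Strand X) → List (Bool × X) → List (Bool × X) → Prop
  | nil : PullAway [] [] []
  | front (d : Bool) (x : X) (u : List (Strand X)) (F B : List (Bool × X)) :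
      PullAway u F B → PullAway (⟨true, d, x⟩ :: u) ((d, x) :: F) B
  | back (d : Bool) (x y : X) (u u' : List (Strand X)) (F B : List (Bool × X)) :
      Slide d x u u' y → PullAway u' F B → PullAway (⟨false, d, x⟩ :: u) F (B ++ [(d, y)])

namespace LinkDiagram

/-- The doubled diagram `W(D)`. -/
def double (D : LinkDiagram) : LinkDiagram where
  slices := D.slices.flatMap Slice.double
  isTangle := D.isTangle.double

/-- The line of `W(D)` that corresponds to the `j`-th line of `D`. -/
def doubleLevel (D : LinkDiagram) (j : ℕ) : ℕ :=
  ((D.slices.take j).flatMap Slice.double).length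

/-- The disjoint union of `D` and, on its right, its horizontal mirror image with the opposite
orientation.  The `j`-th line of `D` has become the `2 * j`-th line. -/
def besideMirror (D : LinkDiagram) : LinkDiagram where
  slices := D.slices.flatMap Slice.besideMirror
  isTangle := D.isTangle.besideMirror

variable {D : LinkDiagram} {X : Type*} [Biquandle X]

/-- Doubling: `C₁` is a biquandle coloring of the doubled diagram in which, away from the
crossings of `D`, both strings of each parallel pair receive the color of the quandle
coloring `C`. -/
def IsDoubled (C : D.QuandleColoring (DerivedQuandle X)) (C₁ : D.double.BiquandleColoring X) :
    Prop :=
  ∀ j, C₁.row (D.doubleLevel j) =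
    (C.row j).flatMap fun s => [(true, s.2.toBase), (false, s.2.toBase)]

/-- Pulling away: on each horizontal line of `D`, the copies of the strings are pulled away from
the doubled row, with the colors transported by the coloring condition at each new crossing, and
`C₂` is a coloring of the disjoint union having the resulting colors on that line. -/
def IsPulledAway (C₁ : D.double.BiquandleColoring X) (C₂ : D.besideMirror.BiquandleColoring X) :
    Prop :=
  ∀ j, ∃ F B : List (Bool × X),
    PullAway (List.zipWith (fun f s => (⟨f, s.1, s.2⟩ : Strand X))
      (frontTags (D.row j)) (C₁.row (D.doubleLevel j))) F B ∧
    C₂.row (2 * j) = F ++ B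

/-- Restricting: `C` is the restriction of `C₂` to the left part `D` of the disjoint union. -/
def IsRestriction (C₂ : D.besideMirror.BiquandleColoring X) (C : D.BiquandleColoring X) : Prop :=
  ∀ j, C.row j = (C₂.row (2 * j)).take (D.row j).length

/-- `D.Path γ R`: an arc from the unbounded region to the region `R` that crosses the diagram
transversely at the points listed in `γ`, in the order from the end of the arc to its start; the
entry is marked `true` if the arc crosses in the direction of the normal vector. -/
inductive Path (D : LinkDiagram) : List (Bool × D.Point) → D.Region → Prop
  | start : Path D [] D.unbounded
  | along (γ p) : Path D γ (D.specified p) → Path D ((true, p) :: γ) (D.opposite p)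
  | against (γ p) : Path D γ (D.opposite p) → Path D ((false, p) :: γ) (D.specified p)

/-- `PushOut C γ y a`: a semi-arc of color `y`, reached by the arc `γ` from its specified region,
is pushed out along `γ` over all strings that `γ` crosses, and the head of the pushed-out part has
color `a`.  Draw `γ` from left to right: the semi-arc is then directed downward and the crossed
strings are downward or upward as `γ` crosses them along or against the normal vector.  The upper
boundary of the pushed-out part goes from top right, over the string `p`, to bottom left, while
`p` enters from top left with its original color and goes on below with some color `t`. -/
inductive PushOut (C : D.BiquandleColoring X) : List (Bool × D.Point) → X → X → Prop
  | nil (y) : PushOut C [] y y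
  | cons (e : Bool) (p : D.Point) (γ : List (Bool × D.Point)) (y z t a : X) :
      (Quad.ofEnds e true false (C.toFun (D.semiArc p)) y z t).IsBiquandleColored →
      PushOut C γ z a → PushOut C ((e, p) :: γ) y a

end LinkDiagram

/-! Each map `x ↦ overOp x y` is an automorphism of the derived quandle (`star_over`). Read a
horizontal line from the left, where the unbounded region lies, and carry along a state: an
automorphism of the derived quandle that starts as the identity and is multiplied on the left by
`overAut c` at a downward string of biquandle color `c`, by its inverse at an upward one. The
dictionary between the two kinds of colors is then `c = f • b`, where `b` is the quandle color and
`f` is the state of the specified region. For a downward string this region is on its left and `c`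
is immediate; for an upward string it lies beyond the string, and solving for `c` gives `c = k (f •
b)` with `f` the state on the left. So each row translates bijectively in both directions (`psiRow`,
`phiRow`).

The translation respects the coloring conditions. The biquandle axiom `over_over` says that the
state does not depend on the side on which a crossing is passed (`foldl_step_cross`), so states live
on regions; the definition of `star` then turns the biquandle condition into the quandle one
(`phiRow_cross`). The converse `psiRow_cross` follows from the uniqueness of the lower colors given
the upper ones. A coloring of the diagram is the same as a compatible sequence of rows, so the row
maps from the state `1` give `Ψ` and `Φ`.

The three descriptions compute the same states. The associated group acts on states from the right,
and `psi p a` is the orbit point of `1` under `p`, applied to `a`. Pushing out along an arc undoes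
the state one factor at a time (`pushOut_iff`). Pulling a copy of a string to the right under
parallel pairs leaves its color unchanged and multiplies the state of everything that it passes by
one factor (`slide_true`, `slide_false`), so that the front row becomes `psiRow`
(`pullAway_strands`). -/

namespace Biquandle

variable {X : Type*} [Biquandle X]

/-! ### The maps `overOp · y` as automorphisms of the derived quandle -/

theorem k_over_self (x : X) : k (overOp x x) = x :=
  over_self_bijective.1 (over_k_k _)

theorem overInv_k (x : X) : overInv x (k x) = k x :=
  over_cancel (k x) (by rw [over_overInv, over_k_k])

variable (X) in
/-- The group of automorphisms of the derived quandle. -/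
def starAut : Subgroup (Equiv.Perm X) where
  carrier := {f | ∀ x y, f (star x y) = star (f x) (f y)}
  mul_mem' hf hg x y := by
    rw [Equiv.Perm.mul_apply, hg x y, hf]
    rfl
  one_mem' _ _ := rfl
  inv_mem' {f} hf x y := by
    rw [Equiv.Perm.inv_eq_iff_eq, hf]
    simp

theorem smul_star (f : starAut X) (x y : X) : f • star x y = star (f • x) (f • y) :=
  f.2 x y

/-- The automorphism `x ↦ overOp x y` of the derived quandle. -/
noncomputable def overAut (y : X) : starAut X :=
  ⟨Equiv.ofBijective _ (over_bijective y), fun x z => star_over x z y⟩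

@[simp]
theorem overAut_smul (x y : X) : overAut y • x = overOp x y := rfl

@[simp]
theorem overAut_inv_smul (x y : X) : (overAut y)⁻¹ • x = overInv x y := rfl

theorem starAut_ext {f g : starAut X} (h : ∀ x : X, f • x = g • x) : f = g :=
  Subtype.ext (Equiv.ext h)

/-- This is the axiom `over_over` read as an identity of automorphisms. It is the only relation
between the factors of a state that is ever needed. -/
theorem overAut_mul (x y : X) :
    overAut (overOp y x) * overAut x = overAut (underOp x y) * overAut y :=
  starAut_ext fun z => by
    simpa [mul_smul] using over_over z x y

end Biquandle

/-! ### The lower colors at a crossing are determined by the upper ones -/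

open Biquandle in
-- Depending on the orientations and the crossing information, the two upper ends are `i, j`, or `k,
-- l`, or `i, l`, or `j, k`. The four cases use, in this order, nothing, the bijectivity of the
-- switch map, that of `overOp · i` and that of `underOp · j`.
theorem Quad.existsUnique_isBiquandleColored {X : Type*} [Biquandle X] (a b o : Bool) (x y : X) :
    ∃! p : X × X, (Quad.ofEnds a b o x y p.1 p.2).IsBiquandleColored := by
  have h1 (i j : X) : ∃! p : X × X, underOp i j = p.1 ∧ overOp j i = p.2 :=
    ⟨(_, _), ⟨rfl, rfl⟩, fun p h => Prod.ext h.1.symm h.2.symm⟩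
  have h2 (k l : X) : ∃! p : X × X, underOp p.1 p.2 = k ∧ overOp p.2 p.1 = l := by
    obtain ⟨p, hp⟩ := (switch_bijective (X := X)).2 (l, k)
    refine ⟨p, ⟨congrArg Prod.snd hp, congrArg Prod.fst hp⟩, fun q hq => ?_⟩
    exact switch_bijective.1 ((Prod.ext hq.2 hq.1).trans hp.symm)
  have h3 (i l : X) : ∃! p : X × X, underOp i p.2 = p.1 ∧ overOp p.2 i = l := by
    refine ⟨(underOp i (overInv l i), overInv l i), ⟨rfl, over_overInv _ _⟩, fun p h => ?_⟩
    have : p.2 = overInv l i := over_cancel i (h.2.trans (over_overInv _ _).symm)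
    exact Prod.ext (by rw [← h.1, this]) this
  have h4 (j k : X) : ∃! p : X × X, underOp p.1 j = k ∧ overOp j p.1 = p.2 := by
    refine ⟨(underInv k j, overOp j (underInv k j)), ⟨under_underInv _ _, rfl⟩, fun p h => ?_⟩
    have : p.1 = underInv k j := (under_bijective j).1 (h.1.trans (under_underInv _ _).symm)
    exact Prod.ext this (by rw [← h.2, this])
  have swap {P : X → X → Prop} (h : ∃! p : X × X, P p.1 p.2) : ∃! p : X × X, P p.2 p.1 := by
    obtain ⟨p, hp, h⟩ := h
    exact ⟨p.swap, hp, fun q hq => Prod.swap_inj.1 (by simpa using h q.swap hq)⟩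
  cases a <;> cases b <;> cases o <;> simp only [Quad.IsBiquandleColored, Quad.ofEnds, if_true, if_false, Bool.false_eq_true] <;>
    first
    | exact h1 _ _ | exact h2 _ _ | exact h3 _ _ | exact h4 _ _
    | exact swap (P := fun p q => underOp _ _ = p ∧ overOp _ _ = q) (h1 _ _)
    | exact swap (P := fun p q => underOp p q = _ ∧ overOp q p = _) (h2 _ _)
    | exact swap (P := fun p q => underOp _ q = p ∧ overOp q _ = _) (h3 _ _)
    | exact swap (P := fun p q => underOp p _ = _ ∧ overOp _ p = q) (h4 _ _)

theorem Quad.eq_of_isBiquandleColored {X : Type*} [Biquandle X] {a b o : Bool}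
    {x y z w z' w' : X} (h : (Quad.ofEnds a b o x y z w).IsBiquandleColored)
    (h' : (Quad.ofEnds a b o x y z' w').IsBiquandleColored) : z = z' ∧ w = w' :=
  Prod.mk.inj ((Quad.existsUnique_isBiquandleColored a b o x y).unique (y₁ := (z, w))
    (y₂ := (z', w')) h h')

/-- The quandle coloring condition at one crossing, including that the over string keeps its
color. -/
def Quad.IsQuandleColored {Q : Type*} [Quandle Q] (q : Quad Q) : Prop :=
  Shelf.act q.j q.i = q.k ∧ q.j = q.l

theorem Quad.eq_of_isQuandleColored {Q : Type*} [Quandle Q] {a b o : Bool}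
    {x y z w z' w' : Q} (h : (Quad.ofEnds a b o x y z w).IsQuandleColored)
    (h' : (Quad.ofEnds a b o x y z' w').IsQuandleColored) : z = z' ∧ w = w' := by
  have inj (c : Q) {s t : Q} : Shelf.act c s = Shelf.act c t → s = t := (Rack.left_cancel c).1
  cases a <;> cases b <;> cases o <;>
    simp only [Quad.IsQuandleColored, Quad.ofEnds, if_true, if_false, Bool.false_eq_true] at h h' <;>
    grind

/-- Color conditions on a strip: the colors are constant along strings, apart from the crossing,
where they satisfy `P`. -/
inductive Slice.Colored {α : Type*} (P : Quad α → Prop) :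
    Slice → List (Bool × α) → List (Bool × α) → Prop
  | birth (L R d x) : Colored P (.birth (L.map Prod.fst) (R.map Prod.fst) d)
      (L ++ R) (L ++ (d, x) :: (!d, x) :: R)
  | death (L R d x) : Colored P (.death (L.map Prod.fst) (R.map Prod.fst) d)
      (L ++ (d, x) :: (!d, x) :: R) (L ++ R)
  | cross (L R a b o x y z w) : P (Quad.ofEnds a b o x y z w) →
      Colored P (.cross (L.map Prod.fst) (R.map Prod.fst) a b o)
        (L ++ (a, x) :: (b, y) :: R) (L ++ (b, z) :: (a, w) :: R)

@[simp]
theorem DerivedQuandle.toBase_ofBase {X : Type*} (a : X) : (ofBase a).toBase = a := rfl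

@[simp]
theorem DerivedQuandle.ofBase_toBase {X : Type*} (a : DerivedQuandle X) :
    ofBase a.toBase = a := rfl

/-! ### Translating rows of colors by means of the state -/

namespace Biquandle

variable {X : Type*} [Biquandle X]

/-- The effect on the state, an automorphism of the derived quandle, of passing a string with
a biquandle color from left to right. -/
noncomputable def step (f : starAut X) : Bool × X → starAut X
  | (true, c) => overAut c * f
  | (false, c) => (overAut c)⁻¹ * f

/-- The biquandle colors of a row of strings given by quandle colors. -/
noncomputable def psiRow : starAut X → List (Bool × DerivedQuandle X) → List (Bool × X)
  | _, [] => []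
  | f, (true, b) :: u => (true, f • b.toBase) :: psiRow (step f (true, f • b.toBase)) u
  | f, (false, b) :: u =>
    (false, k (f • b.toBase)) :: psiRow (step f (false, k (f • b.toBase))) u

/-- The quandle colors of a row of strings given by biquandle colors. -/
noncomputable def phiRow : starAut X → List (Bool × X) → List (Bool × DerivedQuandle X)
  | _, [] => []
  | f, (true, c) :: u => (true, .ofBase (f⁻¹ • c)) :: phiRow (step f (true, c)) u
  | f, (false, c) :: u =>
    (false, .ofBase ((step f (false, c))⁻¹ • c)) :: phiRow (step f (false, c)) u

/-- Both translations run through the same states, since `step` always uses the biquandle color. For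
an upward string, `over_k_k` confirms that `k` solves the equation for the color. -/
theorem phiRow_psiRow (f : starAut X) (u) : phiRow f (psiRow f u) = u := by
  induction u generalizing f with
  | nil => rfl
  | cons s u ih =>
    obtain ⟨_ | _, b⟩ := s
    · simp [psiRow, phiRow, ih, step, mul_smul, over_k_k]
    · simp [psiRow, phiRow, ih]

theorem psiRow_phiRow (f : starAut X) (u) : psiRow f (phiRow f u) = u := by
  induction u generalizing f with
  | nil => rfl
  | cons s u ih =>
    obtain ⟨_ | _, b⟩ := s
    · simp [psiRow, phiRow, ih, step, mul_smul, k_over_self]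
    · simp [psiRow, phiRow, ih]

@[simp]
theorem map_fst_psiRow (f : starAut X) (u) :
    (psiRow f u).map Prod.fst = u.map Prod.fst := by
  induction u generalizing f with
  | nil => rfl
  | cons s u ih => obtain ⟨_ | _, b⟩ := s <;> simp [psiRow, ih]

@[simp]
theorem map_fst_phiRow (f : starAut X) (u) :
    (phiRow f u).map Prod.fst = u.map Prod.fst := by
  rw [← map_fst_psiRow f, psiRow_phiRow]

theorem phiRow_append (f : starAut X) (u v) :
    phiRow f (u ++ v) = phiRow f u ++ phiRow (u.foldl step f) v := by
  induction u generalizing f with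
  | nil => rfl
  | cons s u ih => obtain ⟨_ | _, b⟩ := s <;> simp [phiRow, ih]

theorem psiRow_append (f : starAut X) (u v) :
    psiRow f (u ++ v) = psiRow f u ++ psiRow ((psiRow f u).foldl step f) v := by
  induction u generalizing f with
  | nil => rfl
  | cons s u ih => obtain ⟨_ | _, b⟩ := s <;> simp [psiRow, ih]

@[simp]
theorem step_step_not (f : starAut X) (d : Bool) (x : X) : step (step f (d, x)) (!d, x) = f := by
  cases d <;> simp [step]

/-- The two legs of a maximum or minimum have the same specified region, hence the same state. -/
theorem phiRow_pair (f : starAut X) (d : Bool) (x : X) :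
    ∃ y, phiRow f [(d, x), (!d, x)] = [(d, y), (!d, y)] := by
  cases d <;> simp [phiRow, step]

theorem psiRow_pair (f : starAut X) (d : Bool) (x) :
    ∃ y, psiRow f [(d, x), (!d, x)] = [(d, y), (!d, y)] := by
  cases d <;> simp [psiRow, step, k_over_self, mul_smul, overInv_k]

/-- In each of the eight crossing types the equality is `overAut_mul` with factors moved across by
inversion. It makes the state a function on regions. -/
theorem foldl_step_cross (f : starAut X) {a b o : Bool} {x y z w : X}
    (h : (Quad.ofEnds a b o x y z w).IsBiquandleColored) :
    [(a, x), (b, y)].foldl step f = [(b, z), (a, w)].foldl step f := by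
  cases a <;> cases b <;> cases o <;>
    simp only [Quad.IsBiquandleColored, Quad.ofEnds, if_true, if_false, Bool.false_eq_true] at h <;>
    obtain ⟨rfl, rfl⟩ := h <;>
    simp only [List.foldl, step, ← mul_assoc, ← mul_inv_rev, overAut_mul] <;>
    simp only [mul_assoc, inv_mul_eq_iff_eq_mul, eq_inv_mul_iff_mul_eq] <;>
    first
    | simp [← mul_assoc, ← overAut_mul]; done
    | simp [← mul_assoc, overAut_mul]

/-- Here `g` is the state of the specified region of the crossing. This region is also specified for
`i` and `j`; that of `k` lies across the over half `j`, and that of `l` across the under half `i`,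
whence the extra factors. -/
theorem isQuandleColored_state (g : starAut X) {q : Quad X} (h : q.IsBiquandleColored) :
    Quad.IsQuandleColored (Q := DerivedQuandle X) ⟨.ofBase (g⁻¹ • q.i), .ofBase (g⁻¹ • q.j),
      .ofBase ((overAut q.j * g)⁻¹ • q.k), .ofBase ((overAut q.i * g)⁻¹ • q.l)⟩ := by
  rw [← h.1, ← h.2]
  refine ⟨?_, ?_⟩
  · change star (g⁻¹ • q.i) (g⁻¹ • q.j) = (overAut q.j * g)⁻¹ • underOp q.i q.j
    rw [← smul_star]
    simp [mul_smul, star]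
  · simp [mul_smul, overInv_over]

theorem phiRow_cross (f : starAut X) {a b o : Bool} {x y z w : X}
    (h : (Quad.ofEnds a b o x y z w).IsBiquandleColored) :
    ∃ x' y' z' w', phiRow f [(a, x), (b, y)] = [(a, x'), (b, y')] ∧
      phiRow f [(b, z), (a, w)] = [(b, z'), (a, w')] ∧
      (Quad.ofEnds a b o x' y' z' w').IsQuandleColored := by
  have e := foldl_step_cross f h
  cases a <;> cases b <;> refine ⟨_, _, _, _, rfl, rfl, ?_⟩ <;>
    simp only [List.foldl, step] at e ⊢
  -- Both strings upward: the specified region of the crossing is the right one.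
  · have e' : (overAut z)⁻¹ * f = overAut w * ((overAut y)⁻¹ * ((overAut x)⁻¹ * f)) := by
      simp [e]
    rw [← e, e']
    cases o <;>
      simpa [Quad.ofEnds] using isQuandleColored_state ((overAut y)⁻¹ * ((overAut x)⁻¹ * f)) h
  -- Here the specified region is the upper one, in the next case the lower one, and for two
  -- downward strings the left one, with state `f` itself.
  · have e' : (overAut w)⁻¹ * (overAut z * f) = overAut y * ((overAut x)⁻¹ * f) := e.symm
    have e'' : f = overAut x * ((overAut x)⁻¹ * f) := by simp
    rw [e']
    cases o <;>
      simpa [Quad.ofEnds] using isQuandleColored_state ((overAut x)⁻¹ * f) h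
  · rw [e]
    cases o <;>
      simpa [Quad.ofEnds] using isQuandleColored_state ((overAut z)⁻¹ * f) h
  · cases o <;> simpa [Quad.ofEnds] using isQuandleColored_state f h

/-- No second computation is needed: complete the translated upper colors to a biquandle-colored
crossing and translate it back by `phiRow_cross`. The result has the given upper colors, so its
lower colors are the given ones too. -/
theorem psiRow_cross (f : starAut X) {a b o : Bool} {x y z w : DerivedQuandle X}
    (h : (Quad.ofEnds a b o x y z w).IsQuandleColored) :
    ∃ x' y' z' w', psiRow f [(a, x), (b, y)] = [(a, x'), (b, y')] ∧
      psiRow f [(b, z), (a, w)] = [(b, z'), (a, w')] ∧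
      (Quad.ofEnds a b o x' y' z' w').IsBiquandleColored := by
  obtain ⟨x', y', e⟩ : ∃ x' y', psiRow f [(a, x), (b, y)] = [(a, x'), (b, y')] := by
    cases a <;> cases b <;> exact ⟨_, _, rfl⟩
  obtain ⟨⟨z', w'⟩, hB, -⟩ := Quad.existsUnique_isBiquandleColored a b o x' y'
  obtain ⟨x₁, y₁, z₁, w₁, e₁, e₂, hQ⟩ := phiRow_cross f hB
  rw [← e, phiRow_psiRow] at e₁
  obtain ⟨rfl, rfl⟩ : x = x₁ ∧ y = y₁ := by simpa using e₁
  obtain ⟨rfl, rfl⟩ := Quad.eq_of_isQuandleColored h hQ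
  exact ⟨x', y', z', w', e, by rw [← e₂, psiRow_phiRow], hB⟩

/-- The strings to the right of the event are translated alike on both boundaries, because the state
on reaching them is the same: an arch cancels and a crossing preserves the state. -/
theorem phiRow_colored (f : starAut X) {s : Slice} {U V : List (Bool × X)}
    (h : s.Colored Quad.IsBiquandleColored U V) :
    s.Colored Quad.IsQuandleColored (phiRow f U) (phiRow f V) := by
  have e (L : List (Bool × X)) (s t R) : L ++ s :: t :: R = L ++ ([s, t] ++ R) := rfl
  cases h with
  | birth L R d x =>
    obtain ⟨y, hy⟩ := phiRow_pair (L.foldl step f) d x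
    rw [e, phiRow_append, phiRow_append, phiRow_append, hy, ← map_fst_phiRow f L,
      ← map_fst_phiRow (L.foldl step f) R]
    simp only [List.foldl_cons, List.foldl_nil, step_step_not]
    exact .birth _ _ d y
  | death L R d x =>
    obtain ⟨y, hy⟩ := phiRow_pair (L.foldl step f) d x
    rw [e, phiRow_append, phiRow_append, phiRow_append, hy, ← map_fst_phiRow f L,
      ← map_fst_phiRow (L.foldl step f) R]
    simp only [List.foldl_cons, List.foldl_nil, step_step_not]
    exact .death _ _ d y
  | cross L R a b o x y z w h =>
    obtain ⟨x', y', z', w', e₁, e₂, h'⟩ := phiRow_cross (L.foldl step f) h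
    have e₃ := foldl_step_cross (L.foldl step f) h
    rw [e, e, phiRow_append, phiRow_append, phiRow_append, phiRow_append, e₁, e₂, e₃,
      ← map_fst_phiRow f L,
      ← map_fst_phiRow ([(b, z), (a, w)].foldl step (L.foldl step f)) R]
    exact .cross _ _ a b o x' y' z' w' h'

theorem psiRow_colored (f : starAut X) {s : Slice} {U V : List (Bool × DerivedQuandle X)}
    (h : s.Colored Quad.IsQuandleColored U V) :
    s.Colored Quad.IsBiquandleColored (psiRow f U) (psiRow f V) := by
  have e {Y : Type _} (L : List (Bool × Y)) (s t R) : L ++ s :: t :: R = L ++ ([s, t] ++ R) := rfl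
  cases h with
  | birth L R d x =>
    obtain ⟨y, hy⟩ := psiRow_pair ((psiRow f L).foldl step f) d x
    rw [e, psiRow_append, psiRow_append, psiRow_append, hy, ← map_fst_psiRow f L,
      ← map_fst_psiRow ((psiRow f L).foldl step f) R]
    simp only [List.foldl_cons, List.foldl_nil, step_step_not]
    exact .birth _ _ d y
  | death L R d x =>
    obtain ⟨y, hy⟩ := psiRow_pair ((psiRow f L).foldl step f) d x
    rw [e, psiRow_append, psiRow_append, psiRow_append, hy, ← map_fst_psiRow f L,
      ← map_fst_psiRow ((psiRow f L).foldl step f) R]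
    simp only [List.foldl_cons, List.foldl_nil, step_step_not]
    exact .death _ _ d y
  | cross L R a b o x y z w h =>
    obtain ⟨x', y', z', w', e₁, e₂, h'⟩ := psiRow_cross ((psiRow f L).foldl step f) h
    have e₃ := foldl_step_cross ((psiRow f L).foldl step f) h'
    rw [e, e, psiRow_append, psiRow_append, psiRow_append, psiRow_append, e₁, e₂, e₃,
      ← map_fst_psiRow f L,
      ← map_fst_psiRow ([(b, z'), (a, w')].foldl step ((psiRow f L).foldl step f)) R]
    exact .cross _ _ a b o x' y' z' w' h'

/-! ### The action of the associated group on states, and the map `ψ` -/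

/-- The effect on the state of passing a downward string with a quandle color. -/
noncomputable def shift (b : X) : Equiv.Perm (starAut X) where
  toFun f := overAut (f • b) * f
  invFun f := (overAut (k (f • b)))⁻¹ * f
  left_inv f := by simp [mul_smul, k_over_self]
  right_inv f := by simp [mul_smul, overInv_k]

/-- The right action of the associated group on the states. -/
noncomputable def shiftHom :
    AssocGroup (DerivedQuandle X) →* (Equiv.Perm (starAut X))ᵐᵒᵖ :=
  PresentedGroup.toGroup (f := fun b => .op (shift b.toBase)) (by
    rintro _ ⟨x, y, rfl⟩
    rw [map_mul, map_inv, map_mul, map_mul, mul_inv_eq_one]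
    simp only [FreeGroup.lift_apply_of]
    refine MulOpposite.unop_injective (Equiv.ext fun f => ?_)
    change overAut ((overAut (f • x.toBase) * f) • y.toBase) * (overAut (f • x.toBase) * f) =
      overAut ((overAut (f • y.toBase) * f) • star x.toBase y.toBase) *
        (overAut (f • y.toBase) * f)
    -- As `f` is an automorphism, `f • star x y` followed by `overOp · (f • y)` is `underOp (f • x)
    -- (f • y)`, so the relation becomes `overAut_mul` for `f • x` and `f • y`.
    rw [mul_smul, mul_smul, overAut_smul, overAut_smul, ← mul_assoc, ← mul_assoc, smul_star,
      over_star, overAut_mul])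

/-- The state given by an element of the associated group. -/
noncomputable def state (p : AssocGroup (DerivedQuandle X)) : starAut X :=
  (shiftHom p).unop 1

theorem state_one : state (1 : AssocGroup (DerivedQuandle X)) = 1 := by
  simp [state]

theorem state_mul (p : AssocGroup (DerivedQuandle X)) (b) :
    state (p * .of b) = overAut (state p • b.toBase) * state p := by
  have : shiftHom (.of b) = .op (shift b.toBase) := PresentedGroup.toGroup.of _
  rw [state, map_mul, this]
  rfl

theorem state_mul_inv (p : AssocGroup (DerivedQuandle X)) (b) :
    state (p * (AssocGroup.of b)⁻¹) = (overAut (k (state p • b.toBase)))⁻¹ * state p := by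
  have : shiftHom (.of b) = .op (shift b.toBase) := PresentedGroup.toGroup.of _
  rw [state, map_mul, map_inv, this]
  rfl

/-- The map from pairs (group element, quandle element) to `X`. -/
noncomputable def psi (p : AssocGroup (DerivedQuandle X)) (a : DerivedQuandle X) : X :=
  state p • a.toBase

theorem isPsi_psi : IsPsi (psi (X := X)) where
  one a := by simp [psi, state_one]
  mul p a b := by simp [psi, state_mul, mul_smul]
  mul_inv p a b := by simp [psi, state_mul_inv, mul_smul]

/-- The recursion expresses all values at `p * b` and `p * b⁻¹` by values at `p`, and the generators
generate the group. -/
theorem _root_.IsPsi.eq {ψ ψ' : AssocGroup (DerivedQuandle X) → DerivedQuandle X → X}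
    (h : IsPsi ψ) (h' : IsPsi ψ') : ψ = ψ' := by
  funext p
  have hp : p ∈ Subgroup.closure (Set.range (AssocGroup.of (Q := DerivedQuandle X))) := by
    have := PresentedGroup.closure_range_of {w : FreeGroup (DerivedQuandle X) | ∃ x y,
      w = (FreeGroup.of x * FreeGroup.of y) * (FreeGroup.of y * FreeGroup.of (Shelf.act y x))⁻¹}
    exact this ▸ Subgroup.mem_top p
  induction hp using Subgroup.closure_induction_right with
  | one => exact funext fun a => (h.one a).trans (h'.one a).symm
  | mul_right p _ _ hb ih =>
    obtain ⟨b, rfl⟩ := hb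
    exact funext fun a => by rw [h.mul, h'.mul, ih]
  | mul_inv_cancel p _ _ hb ih =>
    obtain ⟨b, rfl⟩ := hb
    exact funext fun a => by rw [h.mul_inv, h'.mul_inv, ih]

/-- The effect on an element of the associated group of passing a string from left to right. -/
def groupStep {Q : Type*} [Quandle Q] (p : AssocGroup Q) : Bool × Q → AssocGroup Q
  | (true, b) => p * .of b
  | (false, b) => p * (AssocGroup.of b)⁻¹

@[simp]
theorem groupStep_groupStep_not {Q : Type*} [Quandle Q] (p : AssocGroup Q) (d : Bool) (x : Q) :
    groupStep (groupStep p (d, x)) (!d, x) = p := by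
  cases d <;> simp [groupStep]

theorem _root_.AssocGroup.of_mul_of {Q : Type*} [Quandle Q] (x y : Q) :
    AssocGroup.of x * AssocGroup.of y = AssocGroup.of y * AssocGroup.of (Shelf.act y x) := by
  have := PresentedGroup.one_of_mem (rels := {w : FreeGroup Q | ∃ x y : Q,
    w = (FreeGroup.of x * FreeGroup.of y) *
      (FreeGroup.of y * FreeGroup.of (Shelf.act y x))⁻¹}) ⟨x, y, rfl⟩
  rw [map_mul, map_inv, mul_inv_eq_one, map_mul, map_mul] at this
  exact this

/-- The counterpart of `foldl_step_cross` for region colors; here the defining relation of the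
associated group replaces `overAut_mul`. -/
theorem foldl_groupStep_cross {Q : Type*} [Quandle Q] (p : AssocGroup Q) {a b o : Bool}
    {x y z w : Q} (h : (Quad.ofEnds a b o x y z w).IsQuandleColored) :
    [(a, x), (b, y)].foldl groupStep p = [(b, z), (a, w)].foldl groupStep p := by
  have aux (i j : Q) : (AssocGroup.of (Shelf.act j i))⁻¹ * (AssocGroup.of j)⁻¹ =
      (AssocGroup.of j)⁻¹ * (AssocGroup.of i)⁻¹ := by
    rw [← mul_inv_rev, ← mul_inv_rev, AssocGroup.of_mul_of i j]
  have aux' (i j : Q) : AssocGroup.of (Shelf.act j i) * (AssocGroup.of j)⁻¹ =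
      (AssocGroup.of j)⁻¹ * AssocGroup.of i := by
    rw [mul_inv_eq_iff_eq_mul, mul_assoc, AssocGroup.of_mul_of, inv_mul_cancel_left]
  have aux'' (i j : Q) : AssocGroup.of j * (AssocGroup.of (Shelf.act j i))⁻¹ =
      (AssocGroup.of i)⁻¹ * AssocGroup.of j := by
    rw [mul_inv_eq_iff_eq_mul, mul_assoc, ← AssocGroup.of_mul_of, inv_mul_cancel_left]
  cases a <;> cases b <;> cases o <;>
    simp only [Quad.IsQuandleColored, Quad.ofEnds, if_true, if_false, Bool.false_eq_true] at h <;>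
    obtain ⟨rfl, rfl⟩ := h <;>
    simp [groupStep, mul_assoc, aux, aux', aux'', ← AssocGroup.of_mul_of]

end Biquandle

/-! ### Colorings of a diagram as sequences of colored rows -/

namespace Slice

/-- The color at a place on the boundary of a strip. -/
def colorAt {α : Type*} (U V : List (Bool × α)) (e : ℕ ⊕ ℕ) : Option α :=
  (e.elim (U[·]?) (V[·]?)).map Prod.snd

theorem Colored.map_fst {α : Type*} {P : Quad α → Prop} {s : Slice} {U V : List (Bool × α)}
    (h : s.Colored P U V) : U.map Prod.fst = s.top ∧ V.map Prod.fst = s.bot := by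
  cases h <;> simp [top, bot]

theorem Colored.colorAt_eq {α : Type*} {P : Quad α → Prop} {s : Slice} {U V : List (Bool × α)}
    (h : s.Colored P U V) {e f : ℕ ⊕ ℕ} (hJ : s.Joins e f) : colorAt U V e = colorAt U V f := by
  cases h <;> cases hJ <;> simp_all [colorAt, List.getElem?_append, List.getElem?_cons] <;> grind

theorem Colored.quad {α : Type*} {P : Quad α → Prop} {l r : List Bool} {a b o : Bool}
    {U V : List (Bool × α)} (h : (Slice.cross l r a b o).Colored P U V) {x y z w : α}
    (hx : colorAt U V (.inl l.length) = some x) (hy : colorAt U V (.inl (l.length + 1)) = some y)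
    (hz : colorAt U V (.inr l.length) = some z) (hw : colorAt U V (.inr (l.length + 1)) = some w) :
    P (Quad.ofEnds a b o x y z w) := by
  cases h
  simp_all [colorAt]

/-- Passes from conditions on points to the shape of the two rows: the joins force the colors to the
left and right of the event to agree, and an arch to have one color. -/
theorem colored_of_colorAt {α : Type*} {P : Quad α → Prop} {s : Slice} {U V : List (Bool × α)}
    (hU : U.map Prod.fst = s.top) (hV : V.map Prod.fst = s.bot)
    (hJ : ∀ e f, s.Joins e f → colorAt U V e = colorAt U V f)
    (hP : ∀ l r a b o x y z w, s = cross l r a b o →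
      colorAt U V (.inl l.length) = some x → colorAt U V (.inl (l.length + 1)) = some y →
      colorAt U V (.inr l.length) = some z → colorAt U V (.inr (l.length + 1)) = some w →
      P (Quad.ofEnds a b o x y z w)) : s.Colored P U V := by
  have key {M N : List (Bool × α)} (h : M.map Prod.fst = N.map Prod.fst)
      (h' : ∀ i < M.length, M[i]?.map Prod.snd = N[i]?.map Prod.snd) : M = N := by
    have hl : M.length = N.length := by simpa using congrArg List.length h
    refine List.ext_getElem hl fun i hi hi' => Prod.ext ?_ ?_
    · have := congrArg (·[i]?) h
      simpa [hi, hi'] using this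
    · simpa [hi, hi'] using h' i hi
  cases s with
  | birth l r d =>
    obtain ⟨L, R, rfl, rfl, rfl⟩ := List.map_eq_append_iff.1 hU
    obtain ⟨L', V', rfl, hL, hV'⟩ := List.map_eq_append_iff.1 hV
    obtain ⟨⟨d₁, x⟩, V₁, rfl, hd, hV₁⟩ := List.map_eq_cons_iff.1 hV'
    obtain ⟨⟨d₂, x'⟩, R', rfl, hd', hR⟩ := List.map_eq_cons_iff.1 hV₁
    have hlen : L'.length = L.length := by simpa using congrArg List.length hL
    obtain rfl : L = L' := key hL.symm fun i hi => by
      have := hJ _ _ (.birth_left _ (R.map Prod.fst) d i (by simpa using hi))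
      simpa [colorAt, List.getElem?_append, hi, hlen] using this
    obtain rfl : R = R' := key hR.symm fun i hi => by
      have := hJ _ _ (.birth_right (L.map Prod.fst) (R.map Prod.fst) d (L.length + i) (by simp))
      simpa [colorAt, List.getElem?_append, add_assoc] using this
    have := hJ _ _ (.birth_arch (L.map Prod.fst) (R.map Prod.fst) d)
    obtain rfl : x = x' := by simpa [colorAt] using this
    obtain rfl : d₁ = d := hd
    obtain rfl : d₂ = !d₁ := hd'
    exact .birth L R d₁ x
  | death l r d =>
    obtain ⟨L, R, rfl, rfl, rfl⟩ := List.map_eq_append_iff.1 hV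
    obtain ⟨L', V', rfl, hL, hV'⟩ := List.map_eq_append_iff.1 hU
    obtain ⟨⟨d₁, x⟩, V₁, rfl, hd, hV₁⟩ := List.map_eq_cons_iff.1 hV'
    obtain ⟨⟨d₂, x'⟩, R', rfl, hd', hR⟩ := List.map_eq_cons_iff.1 hV₁
    have hlen : L'.length = L.length := by simpa using congrArg List.length hL
    obtain rfl : L = L' := key hL.symm fun i hi => by
      have := hJ _ _ (.death_left _ (R.map Prod.fst) d i (by simpa using hi))
      simpa [colorAt, List.getElem?_append, hi, hlen] using this.symm
    obtain rfl : R = R' := key hR.symm fun i hi => by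
      have := hJ _ _ (.death_right (L.map Prod.fst) (R.map Prod.fst) d (L.length + i) (by simp))
      simpa [colorAt, List.getElem?_append, add_assoc] using this.symm
    have := hJ _ _ (.death_arch (L.map Prod.fst) (R.map Prod.fst) d)
    obtain rfl : x = x' := by simpa [colorAt] using this
    obtain rfl : d₁ = d := hd
    obtain rfl : d₂ = !d₁ := hd'
    exact .death L R d₁ x
  | cross l r a b o =>
    obtain ⟨L, U', rfl, rfl, hU'⟩ := List.map_eq_append_iff.1 hU
    obtain ⟨⟨a', x⟩, U₁, rfl, ha, hU₁⟩ := List.map_eq_cons_iff.1 hU'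
    obtain ⟨⟨b', y⟩, R, rfl, hb, rfl⟩ := List.map_eq_cons_iff.1 hU₁
    obtain ⟨L', V', rfl, hL, hV'⟩ := List.map_eq_append_iff.1 hV
    obtain ⟨⟨b'', z⟩, V₁, rfl, hb', hV₁⟩ := List.map_eq_cons_iff.1 hV'
    obtain ⟨⟨a'', w⟩, R', rfl, ha', hR⟩ := List.map_eq_cons_iff.1 hV₁
    have hlen : L'.length = L.length := by simpa using congrArg List.length hL
    obtain rfl : L = L' := key hL.symm fun i hi => by
      have := hJ _ _ (.cross_left _ (R.map Prod.fst) a b o i (by simpa using hi))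
      simpa [colorAt, List.getElem?_append, hi, hlen] using this
    obtain rfl : R = R' := key hR.symm fun i hi => by
      have := hJ _ _ (.cross_right (L.map Prod.fst) (R.map Prod.fst) a b o (L.length + (i + 2))
        (by simp))
      simpa [colorAt, List.getElem?_append, add_assoc] using this
    obtain rfl : a' = a := ha
    obtain rfl : b' = b := hb
    obtain rfl : b'' = b' := hb'
    obtain rfl : a'' = a' := ha'
    exact .cross L R a'' b'' o x y z w
      (hP _ _ _ _ _ x y z w rfl (by simp [colorAt]) (by simp [colorAt]) (by simp [colorAt])
        (by simp [colorAt]))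

end Slice

/-- The `match` has the form of the one in `LinkDiagram.row`; its default `v` is `[]` for a link, so
that below the last strip the row is empty. -/
theorem IsTangle.bot_eq {u v : List Bool} {L : List Slice} (h : IsTangle u L v) {j : ℕ}
    {s : Slice} (hs : L[j]? = some s) :
    (match L[j + 1]? with | some t => t.top | none => v) = s.bot := by
  induction L generalizing u j with
  | nil => simp at hs
  | cons t L ih =>
    cases j with
    | zero =>
      obtain rfl : t = s := by simpa using hs
      cases L with
      | nil => exact h.2.symm
      | cons t' L => exact h.2.1
    | succ j => exact ih h.2 hs

namespace LinkDiagram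

variable {D : LinkDiagram}

theorem row_eq_top {j : ℕ} {s : Slice} (hs : D.slices[j]? = some s) : D.row j = s.top := by
  simp [row, hs]

theorem row_eq_bot {j : ℕ} {s : Slice} (hs : D.slices[j]? = some s) : D.row (j + 1) = s.bot :=
  D.isTangle.bot_eq hs

theorem row_eq_nil {j : ℕ} (hj : D.slices.length ≤ j) : D.row j = [] := by
  simp [row, List.getElem?_eq_none hj]

/-- The constructors of `Joins` put no upper bound on positions to the right of the event, so joined
places may lie outside the rows; this happens for both or for neither. -/
theorem exists_point_iff_of_joins {j : ℕ} {s : Slice} (hs : D.slices[j]? = some s) {e f : ℕ ⊕ ℕ}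
    (h : s.Joins e f) :
    (∃ p : D.Point, p.1 = place j e) ↔ ∃ p : D.Point, p.1 = place j f := by
  have key (m : ℕ × ℕ) : (∃ p : D.Point, p.1 = m) ↔ m.2 < (D.row m.1).length :=
    ⟨fun ⟨p, hp⟩ => hp ▸ p.2, fun hm => ⟨⟨m, hm⟩, rfl⟩⟩
  rw [key, key]
  cases h <;> simp [place, row_eq_top hs, row_eq_bot hs, Slice.top, Slice.bot] <;> omega

section Rows

variable {α : Type*} (c : D.Point → α)

theorem length_coloredRow (j : ℕ) : (D.coloredRow c j).length = (D.row j).length := by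
  simp [coloredRow]

theorem map_fst_coloredRow (j : ℕ) : (D.coloredRow c j).map Prod.fst = D.row j := by
  refine List.ext_getElem (by simp [coloredRow]) fun i _ _ => ?_
  simp [coloredRow]

theorem coloredRow_getElem? (p : D.Point) :
    (D.coloredRow c p.1.1)[p.1.2]? = some (D.down p, c p) := by
  have : p.1.2 < (D.coloredRow c p.1.1).length := by rw [length_coloredRow]; exact p.2
  rw [List.getElem?_eq_getElem this]
  simp only [coloredRow, List.getElem_ofFn]
  rfl

theorem colorAt_place {j : ℕ} {e : ℕ ⊕ ℕ} {p : D.Point} (h : p.1 = place j e) :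
    Slice.colorAt (D.coloredRow c j) (D.coloredRow c (j + 1)) e = some (c p) := by
  have := coloredRow_getElem? c p
  rw [h] at this
  cases e <;> simpa [Slice.colorAt, place] using congrArg (Option.map Prod.snd) this

theorem exists_point {j : ℕ} {e : ℕ ⊕ ℕ} {x : α}
    (h : Slice.colorAt (D.coloredRow c j) (D.coloredRow c (j + 1)) e = some x) :
    ∃ p : D.Point, p.1 = place j e ∧ c p = x := by
  obtain ⟨p, hp⟩ : ∃ p : D.Point, p.1 = place j e := by
    cases e with
    | inl i | inr i =>
      refine ⟨⟨(_, i), ?_⟩, rfl⟩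
      rw [← length_coloredRow c]
      by_contra hi
      simp [Slice.colorAt, List.getElem?_eq_none (not_lt.1 hi)] at h
  rw [colorAt_place c hp] at h
  exact ⟨p, hp, Option.some.inj h⟩

theorem colored_coloredRow {P : Quad α → Prop} (hJ : ∀ p q, D.Joined p q → c p = c q)
    (hP : ∀ q, D.IsCrossing q → P ⟨c q.i, c q.j, c q.k, c q.l⟩) {j : ℕ} {s : Slice}
    (hs : D.slices[j]? = some s) :
    s.Colored P (D.coloredRow c j) (D.coloredRow c (j + 1)) := by
  refine Slice.colored_of_colorAt ?_ ?_ ?_ ?_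
  · rw [map_fst_coloredRow, row_eq_top hs]
  · rw [map_fst_coloredRow, row_eq_bot hs]
  · intro e f hef
    refine Option.ext fun x => ⟨fun h => ?_, fun h => ?_⟩
    all_goals
      obtain ⟨p, hp, rfl⟩ := exists_point c h
    · obtain ⟨q, hq⟩ := (exists_point_iff_of_joins hs hef).1 ⟨p, hp⟩
      rw [colorAt_place c hq, hJ p q ⟨j, s, e, f, hs, hef, hp, hq⟩]
    · obtain ⟨q, hq⟩ := (exists_point_iff_of_joins hs hef).2 ⟨p, hp⟩
      rw [colorAt_place c hq, hJ q p ⟨j, s, e, f, hs, hef, hq, hp⟩]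
  · rintro l r a b o x y z w rfl hx hy hz hw
    obtain ⟨tl, htl, rfl⟩ := exists_point c hx
    obtain ⟨tr, htr, rfl⟩ := exists_point c hy
    obtain ⟨bl, hbl, rfl⟩ := exists_point c hz
    obtain ⟨br, hbr, rfl⟩ := exists_point c hw
    have := hP _ ⟨j, l, r, a, b, o, tl, tr, bl, br, hs, htl, htr, hbl, hbr, rfl⟩
    cases a <;> cases b <;> cases o <;> exact this

theorem eq_of_colored {P : Quad α → Prop}
    (h : ∀ j (s : Slice), D.slices[j]? = some s → s.Colored P (D.coloredRow c j) (D.coloredRow c (j + 1)))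
    {p q : D.Point} (hpq : D.Joined p q) : c p = c q := by
  obtain ⟨j, s, e, f, hs, hef, hp, hq⟩ := hpq
  have := (h j s hs).colorAt_eq hef
  rw [colorAt_place c hp, colorAt_place c hq] at this
  exact Option.some.inj this

theorem quad_of_colored {P : Quad α → Prop}
    (h : ∀ j (s : Slice), D.slices[j]? = some s → s.Colored P (D.coloredRow c j) (D.coloredRow c (j + 1)))
    {q : Quad D.Point} (hq : D.IsCrossing q) : P ⟨c q.i, c q.j, c q.k, c q.l⟩ := by
  obtain ⟨j, l, r, a, b, o, tl, tr, bl, br, hs, htl, htr, hbl, hbr, rfl⟩ := hq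
  have := (h j _ hs).quad (colorAt_place c htl) (colorAt_place c htr) (colorAt_place c hbl)
    (colorAt_place c hbr)
  cases a <;> cases b <;> cases o <;> exact this

/-- The strip condition `hu` already forces the orientations in `u j` to be those of the diagram, so
only the colors have to be read off. -/
theorem exists_coloredRow_eq {P : Quad α → Prop} (u : ℕ → List (Bool × α))
    (h0 : ∀ j, D.slices.length ≤ j → u j = [])
    (hu : ∀ j (s : Slice), D.slices[j]? = some s → s.Colored P (u j) (u (j + 1))) :
    ∃ c : D.Point → α, ∀ j, D.coloredRow c j = u j := by
  have hrow (j : ℕ) : D.row j = (u j).map Prod.fst := by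
    by_cases hj : D.slices.length ≤ j
    · rw [row_eq_nil hj, h0 j hj]
      rfl
    · have hs := List.getElem?_eq_getElem (not_le.1 hj)
      rw [(hu j _ hs).map_fst.1, row_eq_top hs]
  refine ⟨fun p => ((u p.1.1)[p.1.2]'(by simpa [hrow] using p.2)).2, fun j => ?_⟩
  refine List.ext_getElem (by simp [coloredRow, hrow]) fun i _ _ => ?_
  simp [coloredRow, hrow]

theorem coloredRow_injective {c c' : D.Point → α} (h : ∀ j, D.coloredRow c j = D.coloredRow c' j) :
    c = c' := by
  funext p
  have := coloredRow_getElem? c p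
  rw [h, coloredRow_getElem?] at this
  exact (congrArg Prod.snd (Option.some.inj this)).symm

end Rows

namespace BiquandleColoring

variable {X : Type*} [Biquandle X]

theorem row_colored (C : D.BiquandleColoring X) {j : ℕ} {s : Slice} (hs : D.slices[j]? = some s) :
    s.Colored Quad.IsBiquandleColored (C.row j) (C.row (j + 1)) :=
  colored_coloredRow _ (fun _ _ h => congrArg C.toFun (Quot.sound h)) C.crossing hs

theorem ext_row {C C' : D.BiquandleColoring X} (h : ∀ j, C.row j = C'.row j) : C = C' := by
  have := coloredRow_injective h
  cases C
  cases C'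
  congr
  funext a
  induction a using Quot.ind with
  | mk p => exact congrFun this p

theorem exists_row_eq (u : ℕ → List (Bool × X)) (h0 : ∀ j, D.slices.length ≤ j → u j = [])
    (hu : ∀ j (s : Slice), D.slices[j]? = some s → s.Colored Quad.IsBiquandleColored (u j) (u (j + 1))) :
    ∃ C : D.BiquandleColoring X, ∀ j, C.row j = u j := by
  obtain ⟨c, hc⟩ := exists_coloredRow_eq u h0 hu
  have h : ∀ j (s : Slice), D.slices[j]? = some s → s.Colored Quad.IsBiquandleColored
      (D.coloredRow c j) (D.coloredRow c (j + 1)) := fun j s hs => by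
    rw [hc, hc]
    exact hu j s hs
  exact ⟨⟨Quot.lift c fun _ _ => eq_of_colored c h, fun _ hq => quad_of_colored c h hq⟩, hc⟩

end BiquandleColoring

namespace QuandleColoring

variable {Q : Type*} [Quandle Q]

theorem row_colored (C : D.QuandleColoring Q) {j : ℕ} {s : Slice} (hs : D.slices[j]? = some s) :
    s.Colored Quad.IsQuandleColored (C.row j) (C.row (j + 1)) := by
  refine colored_coloredRow _ (fun _ _ h => congrArg C.toFun (Quot.sound (Or.inl h)))
    (fun q hq => ⟨C.crossing q hq, ?_⟩) hs
  -- The second half of `IsQuandleColored`, constancy along the over string, holds because arcs pass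
  -- through over crossings.
  have key {p q : D.Point} (h : D.OverJoined p q) : C.toFun (D.arc p) = C.toFun (D.arc q) :=
    congrArg C.toFun (Quot.sound (Or.inr h))
  obtain ⟨j, l, r, a, b, o, tl, tr, bl, br, hs, htl, htr, hbl, hbr, rfl⟩ := hq
  cases o
  · have := key ⟨j, _, _, _, hs, .right l r a b, htr, hbl⟩
    cases a
    exacts [this, this.symm]
  · have := key ⟨j, _, _, _, hs, .left l r a b, htl, hbr⟩
    cases b
    exacts [this.symm, this]

theorem ext_row {C C' : D.QuandleColoring Q} (h : ∀ j, C.row j = C'.row j) : C = C' := by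
  have := coloredRow_injective h
  cases C
  cases C'
  congr
  funext a
  induction a using Quot.ind with
  | mk p => exact congrFun this p

theorem exists_row_eq (u : ℕ → List (Bool × Q)) (h0 : ∀ j, D.slices.length ≤ j → u j = [])
    (hu : ∀ j (s : Slice), D.slices[j]? = some s → s.Colored Quad.IsQuandleColored (u j) (u (j + 1))) :
    ∃ C : D.QuandleColoring Q, ∀ j, C.row j = u j := by
  obtain ⟨c, hc⟩ := exists_coloredRow_eq u h0 hu
  have h : ∀ j (s : Slice), D.slices[j]? = some s → s.Colored Quad.IsQuandleColored
      (D.coloredRow c j) (D.coloredRow c (j + 1)) := fun j s hs => by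
    rw [hc, hc]
    exact hu j s hs
  refine ⟨⟨Quot.lift c ?_, fun _ hq => (quad_of_colored c h hq).1⟩, hc⟩
  rintro p q (hpq | hpq)
  · exact eq_of_colored c h hpq
  obtain ⟨j, s, e, f, hs, hef, hp, hq⟩ := hpq
  have hc := h j s hs
  cases hef with
  | left l r a b =>
    -- The over string supplies two of the four ends; the two ends of the under string are needed to
    -- apply `quad`.
    obtain ⟨tr, htr, -⟩ : ∃ tr : D.Point, tr.1 = place j (.inl (l.length + 1)) ∧ True :=
      ⟨⟨(j, l.length + 1), by simp [row_eq_top hs, Slice.top]⟩, rfl, trivial⟩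
    obtain ⟨bl, hbl, -⟩ : ∃ bl : D.Point, bl.1 = place j (.inr l.length) ∧ True :=
      ⟨⟨(j + 1, l.length), by simp [row_eq_bot hs, Slice.bot]⟩, rfl, trivial⟩
    have := (hc.quad (colorAt_place c hp) (colorAt_place c htr) (colorAt_place c hbl)
      (colorAt_place c hq)).2
    cases b <;> simpa [Quad.ofEnds, eq_comm] using this
  | right l r a b =>
    obtain ⟨tl, htl, -⟩ : ∃ tl : D.Point, tl.1 = place j (.inl l.length) ∧ True :=
      ⟨⟨(j, l.length), by simp [row_eq_top hs, Slice.top]⟩, rfl, trivial⟩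
    obtain ⟨br, hbr, -⟩ : ∃ br : D.Point, br.1 = place j (.inr (l.length + 1)) ∧ True :=
      ⟨⟨(j + 1, l.length + 1), by simp [row_eq_bot hs, Slice.bot]⟩, rfl, trivial⟩
    have := (hc.quad (colorAt_place c htl) (colorAt_place c hp) (colorAt_place c hq)
      (colorAt_place c hbr)).2
    cases a <;> simpa [Quad.ofEnds, eq_comm] using this

end QuandleColoring

end LinkDiagram

/-! ### Quantities carried by regions -/

/-- The strings to the left of a gap on the boundary of a strip. -/
def Slice.leftOf {α : Type*} (U V : List (Bool × α)) (e : ℕ ⊕ ℕ) : List (Bool × α) :=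
  e.elim (U.take ·) (V.take ·)

/-- Invariance needs only cancellation at an arch and exchange at a crossing. The type `T` is left
general to serve both the states and the associated group. -/
theorem Slice.Colored.foldl_eq {α T : Type*} {P : Quad α → Prop} {step : T → Bool × α → T}
    (hpair : ∀ t d x, step (step t (d, x)) (!d, x) = t)
    (hcross : ∀ t a b o x y z w, P (Quad.ofEnds a b o x y z w) →
      [(a, x), (b, y)].foldl step t = [(b, z), (a, w)].foldl step t)
    (t : T) {s : Slice} {U V : List (Bool × α)} (h : s.Colored P U V) {e f : ℕ ⊕ ℕ}
    (hJ : s.JoinsGaps e f) : (leftOf U V e).foldl step t = (leftOf U V f).foldl step t := by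
  have left (L M N : List (Bool × α)) (i : ℕ) (hi : i ≤ (L.map Prod.fst).length) :
      (L ++ M).take i = (L ++ N).take i := by
    rw [List.length_map] at hi
    rw [List.take_append_of_le_length hi, List.take_append_of_le_length hi]
  have right (L : List (Bool × α)) (i : ℕ) (hi : (L.map Prod.fst).length ≤ i) :
      ∃ m, i = L.length + m := Nat.exists_eq_add_of_le (by simpa using hi)
  cases h with
  | birth L R d x =>
    cases hJ with
    | birth_left _ _ _ i hi => exact congrArg (List.foldl step t) (left L _ _ i hi)
    | birth_right _ _ _ i hi =>
      obtain ⟨m, rfl⟩ := right L i hi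
      simp [leftOf, add_assoc, List.take_length_add_append, hpair]
  | death L R d x =>
    cases hJ with
    | death_left _ _ _ i hi => exact congrArg (List.foldl step t) (left L _ _ i hi)
    | death_right _ _ _ i hi =>
      obtain ⟨m, rfl⟩ := right L i hi
      simp [leftOf, add_assoc, List.take_length_add_append, hpair]
  | cross L R a b o x y z w h =>
    cases hJ with
    | cross_left _ _ _ _ _ i hi => exact congrArg (List.foldl step t) (left L _ _ i hi)
    | cross_right _ _ _ _ _ i hi =>
      obtain ⟨m, rfl⟩ := right L i (by omega)
      obtain ⟨m, rfl⟩ : ∃ n, m = n + 2 := Nat.exists_eq_add_of_le' (by simp at hi; omega)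
      have := hcross (L.foldl step t) a b o x y z w h
      simp only [List.foldl_cons, List.foldl_nil] at this
      simp [leftOf, List.take_length_add_append, this]

namespace LinkDiagram

variable {D : LinkDiagram}

/-- The value at a gap is accumulated from the strings on its left, starting with `t` at the left
end of the line, which lies in the unbounded region. -/
theorem exists_region_map {α T : Type*} {P : Quad α → Prop} {step : T → Bool × α → T}
    (hpair : ∀ t d x, step (step t (d, x)) (!d, x) = t)
    (hcross : ∀ t a b o x y z w, P (Quad.ofEnds a b o x y z w) →
      [(a, x), (b, y)].foldl step t = [(b, z), (a, w)].foldl step t)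
    (t : T) {c : D.Point → α}
    (h : ∀ j (s : Slice), D.slices[j]? = some s →
      s.Colored P (D.coloredRow c j) (D.coloredRow c (j + 1))) :
    ∃ R : D.Region → T, R D.unbounded = t ∧
      ∀ p : D.Point,
        R (D.leftRegion p) = ((D.coloredRow c p.1.1).take p.1.2).foldl step t ∧
        R (D.rightRegion p) = ((D.coloredRow c p.1.1).take (p.1.2 + 1)).foldl step t ∧
        R (D.rightRegion p) = step (R (D.leftRegion p)) (D.down p, c p) := by
  refine ⟨Quot.lift (fun g => ((D.coloredRow c g.1.1).take g.1.2).foldl step t) ?_, rfl,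
    fun p => ⟨rfl, rfl, ?_⟩⟩
  · rintro g g' ⟨j, s, e, f, hs, hef, hg, hg'⟩
    have := (h j s hs).foldl_eq hpair hcross t hef
    have key {g : D.Gap} {e} (hg : g.1 = place j e) : (D.coloredRow c g.1.1).take g.1.2 =
        Slice.leftOf (D.coloredRow c j) (D.coloredRow c (j + 1)) e := by
      rw [hg]
      cases e <;> rfl
    change List.foldl step t ((D.coloredRow c g.1.1).take g.1.2) =
      List.foldl step t ((D.coloredRow c g'.1.1).take g'.1.2)
    rw [key hg, key hg', this]
  · change List.foldl step t ((D.coloredRow c p.1.1).take (p.1.2 + 1)) =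
      step (List.foldl step t ((D.coloredRow c p.1.1).take p.1.2)) _
    rw [List.take_add_one, coloredRow_getElem? c p]
    simp

/-- The gaps at the left ends of all lines belong to the unbounded region, and any other gap is
reached from such a one by crossing strings of its line. -/
theorem region_induction {P : D.Region → Prop} (h0 : P D.unbounded)
    (h : ∀ p : D.Point, P (D.specified p) ↔ P (D.opposite p)) (r : D.Region) : P r := by
  have h' (p : D.Point) : P (D.leftRegion p) → P (D.rightRegion p) := by
    have := h p
    unfold specified opposite at this
    split_ifs at this
    exacts [this.1, this.2]
  induction r using Quot.ind with
  | mk g =>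
  obtain ⟨⟨j, i⟩, hj, hi⟩ := g
  change j ≤ _ at hj
  change i ≤ _ at hi
  induction i with
  | zero =>
    induction j with
    | zero => exact h0
    | succ j ih =>
      have hs := List.getElem?_eq_getElem (Nat.lt_of_succ_le hj)
      have := ih (Nat.le_of_succ_le hj) (Nat.zero_le _)
      have e : D.GapJoined ⟨(j, 0), Nat.le_of_succ_le hj, Nat.zero_le _⟩ ⟨(j + 1, 0), hj, hi⟩ := by
        refine ⟨j, _, .inl 0, .inr 0, hs, ?_, rfl, rfl⟩
        cases D.slices[j] with
        | birth => exact .birth_left _ _ _ _ (Nat.zero_le _)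
        | death => exact .death_left _ _ _ _ (Nat.zero_le _)
        | cross => exact .cross_left _ _ _ _ _ _ (Nat.zero_le _)
      exact (congrArg P (Quot.sound e)).mp this
  | succ i ih => exact h' ⟨(j, i), hi⟩ (ih (Nat.le_of_succ_le hi))

theorem exists_path (r : D.Region) : ∃ γ, D.Path γ r :=
  region_induction (P := fun r => ∃ γ, D.Path γ r) ⟨[], .start⟩ (fun p =>
    ⟨fun ⟨γ, h⟩ => ⟨_, .along γ p h⟩, fun ⟨γ, h⟩ => ⟨_, .against γ p h⟩⟩) r

theorem IsRegionColoring.eq {Q : Type*} [Quandle Q] {C : D.QuandleColoring Q}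
    {R R' : D.Region → AssocGroup Q} (h : IsRegionColoring C R) (h' : IsRegionColoring C R') :
    R = R' := by
  refine funext (region_induction (h.unbounded.trans h'.unbounded.symm) fun p => ?_)
  rw [← h.cross p, ← h'.cross p, mul_left_inj]

theorem exists_isRegionColoring {Q : Type*} [Quandle Q] (C : D.QuandleColoring Q) :
    ∃ R, IsRegionColoring C R ∧ ∀ p : D.Point,
      R (D.leftRegion p) = ((C.row p.1.1).take p.1.2).foldl Biquandle.groupStep 1 ∧
      R (D.rightRegion p) = ((C.row p.1.1).take (p.1.2 + 1)).foldl Biquandle.groupStep 1 := by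
  obtain ⟨R, h0, hR⟩ := exists_region_map Biquandle.groupStep_groupStep_not
    (fun t _ _ _ _ _ _ _ h => Biquandle.foldl_groupStep_cross t h) 1
    fun _ _ hs => C.row_colored hs
  refine ⟨R, ⟨h0, fun p => ?_⟩, fun p => ⟨(hR p).1, (hR p).2.1⟩⟩
  have := (hR p).2.2
  unfold specified opposite
  split_ifs with hp <;> rw [this] <;> simp [Biquandle.groupStep, hp]

end LinkDiagram

/-! ### Single colors in translated rows, and pushing out -/

namespace Biquandle

variable {X : Type*} [Biquandle X]

/-- The specified region of the `i`-th string has `i` strings to its left if the string is downward,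
and `i + 1` if it is upward. -/
theorem psiRow_getElem? (p : AssocGroup (DerivedQuandle X)) {u : List (Bool × DerivedQuandle X)}
    {i : ℕ} {d : Bool} {b : DerivedQuandle X} (h : u[i]? = some (d, b)) :
    (psiRow (state p) u)[i]? = some (d, psi (if d then (u.take i).foldl groupStep p
      else (u.take (i + 1)).foldl groupStep p) b) := by
  induction u generalizing p i with
  | nil => simp at h
  | cons s u ih =>
    cases i with
    | zero =>
      obtain rfl : s = (d, b) := by simpa using h
      cases d <;> simp [psiRow, psi, groupStep, state_mul_inv, mul_smul, overInv_k]
    | succ i =>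
      obtain ⟨d', b'⟩ := s
      have := ih (groupStep p (d', b')) (i := i) (by simpa using h)
      cases d' <;> simpa [psiRow, step, groupStep, state_mul_inv, state_mul] using this

theorem phiRow_getElem? (f : starAut X) {u : List (Bool × X)} {i : ℕ} {d : Bool} {c : X}
    (h : u[i]? = some (d, c)) :
    (phiRow f u)[i]? = some (d, .ofBase ((if d then (u.take i).foldl step f
      else (u.take (i + 1)).foldl step f)⁻¹ • c)) := by
  induction u generalizing f i with
  | nil => simp at h
  | cons s u ih =>
    cases i with
    | zero =>
      obtain rfl : s = (d, c) := by simpa using h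
      cases d <;> simp [phiRow]
    | succ i =>
      obtain ⟨d', b'⟩ := s
      have := ih (step f (d', b')) (i := i) (by simpa using h)
      cases d' <;> simpa [phiRow] using this

end Biquandle

namespace LinkDiagram

open Biquandle

variable {D : LinkDiagram} {X : Type*} [Biquandle X]

/-- Crossing a string of color `c` while pushing out applies `overInv · c` or `overOp · c`, which is
exactly the factor by which the inverse states on its two sides differ. As `S` depends on the region
only, so does the outcome. -/
theorem pushOut_iff {C : D.BiquandleColoring X} {S : D.Region → starAut X}
    (h0 : S D.unbounded = 1)
    (hS : ∀ p : D.Point, overAut (C.toFun (D.semiArc p)) * S (D.specified p) = S (D.opposite p))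
    {γ : List (Bool × D.Point)} {r : D.Region} (hγ : D.Path γ r) (y a : X) :
    PushOut C γ y a ↔ (S r)⁻¹ • y = a := by
  induction hγ generalizing y with
  | start =>
    rw [h0, inv_one, one_smul]
    exact ⟨fun h => by cases h; rfl, fun h => h ▸ .nil y⟩
  | along γ p _ ih =>
    have e : (S (D.opposite p))⁻¹ • y =
        (S (D.specified p))⁻¹ • overInv y (C.toFun (D.semiArc p)) := by
      rw [← hS, mul_inv_rev, mul_smul, overAut_inv_smul]
    rw [e, ← ih]
    constructor
    · rintro (_ | ⟨_, _, _, _, z, _, _, hq, h⟩)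
      have : overOp z (C.toFun (D.semiArc p)) = y := hq.2
      rwa [← this, overInv_over]
    · exact fun h => .cons true p γ y (overInv y (C.toFun (D.semiArc p)))
        (underOp (C.toFun (D.semiArc p)) (overInv y (C.toFun (D.semiArc p)))) a ⟨rfl, over_overInv _ _⟩ h
  | against γ p _ ih =>
    have e : (S (D.specified p))⁻¹ • y =
        (S (D.opposite p))⁻¹ • overOp y (C.toFun (D.semiArc p)) := by
      rw [← hS, mul_inv_rev, mul_smul, overAut_inv_smul, overInv_over]
    rw [e, ← ih]
    constructor
    · rintro (_ | ⟨_, _, _, _, z, _, _, hq, h⟩)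
      have : overOp y (C.toFun (D.semiArc p)) = z := hq.2
      rwa [this]
    · exact fun h => .cons false p γ y (overOp y (C.toFun (D.semiArc p)))
        (underOp (C.toFun (D.semiArc p)) y) a ⟨rfl, rfl⟩ h

theorem exists_state_region (C : D.BiquandleColoring X) :
    ∃ S : D.Region → starAut X, S D.unbounded = 1 ∧
      (∀ p : D.Point,
        overAut (C.toFun (D.semiArc p)) * S (D.specified p) = S (D.opposite p)) ∧
      ∀ p : D.Point,
        S (D.leftRegion p) = ((C.row p.1.1).take p.1.2).foldl step 1 ∧
        S (D.rightRegion p) = ((C.row p.1.1).take (p.1.2 + 1)).foldl step 1 := by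
  obtain ⟨S, h0, hS⟩ := exists_region_map step_step_not
    (fun t _ _ _ _ _ _ _ h => foldl_step_cross t h) 1 fun _ _ hs => C.row_colored hs
  refine ⟨S, h0, fun p => ?_, fun p => ⟨(hS p).1, (hS p).2.1⟩⟩
  have := (hS p).2.2
  unfold specified opposite
  split_ifs with hp <;> rw [this] <;> simp [step, hp]

theorem toBase_eq_of_row_eq {C : D.BiquandleColoring X}
    {C' : D.QuandleColoring (DerivedQuandle X)} (h : ∀ j, C'.row j = phiRow 1 (C.row j))
    {S : D.Region → starAut X} (hS : ∀ p : D.Point,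
        S (D.leftRegion p) = ((C.row p.1.1).take p.1.2).foldl step 1 ∧
        S (D.rightRegion p) = ((C.row p.1.1).take (p.1.2 + 1)).foldl step 1) (p : D.Point) :
    (C'.toFun (D.arc p)).toBase = (S (D.specified p))⁻¹ • C.toFun (D.semiArc p) := by
  have h₁ := coloredRow_getElem? (fun p => C'.toFun (D.arc p)) p
  have h₂ := phiRow_getElem? 1 (coloredRow_getElem? (fun p => C.toFun (D.semiArc p)) p)
  change (C'.row _)[_]? = _ at h₁
  change (phiRow 1 (C.row _))[_]? = _ at h₂
  rw [← h, h₁] at h₂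
  have := congrArg Prod.snd (Option.some.inj h₂)
  change C'.toFun (D.arc p) = _ at this
  rw [this]
  unfold specified
  split_ifs with hp
  · rw [(hS p).1]
    rfl
  · rw [(hS p).2]
    rfl

theorem eq_psi_of_row_eq {C : D.BiquandleColoring X}
    {C' : D.QuandleColoring (DerivedQuandle X)} (h : ∀ j, C.row j = psiRow 1 (C'.row j))
    {R : D.Region → AssocGroup (DerivedQuandle X)} (hR : ∀ p : D.Point,
        R (D.leftRegion p) = ((C'.row p.1.1).take p.1.2).foldl groupStep 1 ∧
        R (D.rightRegion p) = ((C'.row p.1.1).take (p.1.2 + 1)).foldl groupStep 1)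
    (p : D.Point) : C.toFun (D.semiArc p) = psi (R (D.specified p)) (C'.toFun (D.arc p)) := by
  have h₁ := coloredRow_getElem? (fun p => C.toFun (D.semiArc p)) p
  have h₂ := psiRow_getElem? 1 (coloredRow_getElem? (fun p => C'.toFun (D.arc p)) p)
  change (C.row _)[_]? = _ at h₁
  change (psiRow (state 1) (C'.row _))[_]? = _ at h₂
  rw [state_one, ← h, h₁] at h₂
  have := congrArg Prod.snd (Option.some.inj h₂)
  change C.toFun (D.semiArc p) = _ at this
  rw [this]
  unfold specified
  split_ifs with hp
  · rw [(hR p).1]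
    rfl
  · rw [(hR p).2]
    rfl

theorem QuandleColoring.row_eq_nil {Q : Type*} [Quandle Q] (C : D.QuandleColoring Q) {j : ℕ}
    (hj : D.slices.length ≤ j) : C.row j = [] :=
  List.length_eq_zero_iff.1 <| by
    rw [QuandleColoring.row, length_coloredRow, LinkDiagram.row_eq_nil hj, List.length_nil]

theorem BiquandleColoring.row_eq_nil (C : D.BiquandleColoring X) {j : ℕ}
    (hj : D.slices.length ≤ j) : C.row j = [] :=
  List.length_eq_zero_iff.1 <| by
    rw [BiquandleColoring.row, length_coloredRow, LinkDiagram.row_eq_nil hj, List.length_nil]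

theorem exists_row_eq_psiRow (C : D.QuandleColoring (DerivedQuandle X)) :
    ∃ C' : D.BiquandleColoring X, ∀ j, C'.row j = psiRow 1 (C.row j) :=
  BiquandleColoring.exists_row_eq _ (fun j hj => by rw [C.row_eq_nil hj]; rfl)
    fun _ _ hs => psiRow_colored 1 (C.row_colored hs)

theorem exists_row_eq_phiRow (C : D.BiquandleColoring X) :
    ∃ C' : D.QuandleColoring (DerivedQuandle X), ∀ j, C'.row j = phiRow 1 (C.row j) :=
  QuandleColoring.exists_row_eq _ (fun j hj => by rw [C.row_eq_nil hj]; rfl)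
    fun _ _ hs => phiRow_colored 1 (C.row_colored hs)

end LinkDiagram

/-! ### Existence and uniqueness of colorings of stacked strips -/

namespace Slice

section Iff

variable {α : Type*} {P : Quad α → Prop} {l r : List Bool} {U V : List (Bool × α)}

theorem colored_birth_iff {d : Bool} : (birth l r d).Colored P U V ↔ ∃ L R x,
    L.map Prod.fst = l ∧ R.map Prod.fst = r ∧ U = L ++ R ∧ V = L ++ (d, x) :: (!d, x) :: R := by
  constructor
  · intro h
    cases h
    exact ⟨_, _, _, rfl, rfl, rfl, rfl⟩
  · rintro ⟨L, R, x, rfl, rfl, rfl, rfl⟩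
    exact .birth L R d x

theorem colored_death_iff {d : Bool} : (death l r d).Colored P U V ↔ ∃ L R x,
    L.map Prod.fst = l ∧ R.map Prod.fst = r ∧ U = L ++ (d, x) :: (!d, x) :: R ∧ V = L ++ R := by
  constructor
  · intro h
    cases h
    exact ⟨_, _, _, rfl, rfl, rfl, rfl⟩
  · rintro ⟨L, R, x, rfl, rfl, rfl, rfl⟩
    exact .death L R d x

theorem colored_cross_iff {a b o : Bool} : (cross l r a b o).Colored P U V ↔ ∃ L R x y z w,
    L.map Prod.fst = l ∧ R.map Prod.fst = r ∧ U = L ++ (a, x) :: (b, y) :: R ∧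
      V = L ++ (b, z) :: (a, w) :: R ∧ P (Quad.ofEnds a b o x y z w) := by
  constructor
  · intro h
    cases h
    exact ⟨_, _, _, _, _, _, rfl, rfl, rfl, rfl, ‹_›⟩
  · rintro ⟨L, R, x, y, z, w, rfl, rfl, rfl, rfl, h⟩
    exact .cross L R a b o x y z w h

theorem Colored.birth_unique {U' : List (Bool × α)} {d : Bool}
    (h : (Slice.birth l r d).Colored P U V) (h' : (Slice.birth l r d).Colored P U' V) :
    U = U' := by
  obtain ⟨L, R, x, rfl, rfl, rfl, rfl⟩ := colored_birth_iff.1 h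
  obtain ⟨L', R', x', hL, hR, rfl, hV⟩ := colored_birth_iff.1 h'
  obtain ⟨rfl, h⟩ := List.append_inj hV (by simpa using (congrArg List.length hL).symm)
  simp_all

theorem Colored.death_unique {V' : List (Bool × α)} {d : Bool}
    (h : (Slice.death l r d).Colored P U V) (h' : (Slice.death l r d).Colored P U V') :
    V = V' := by
  obtain ⟨L, R, x, rfl, rfl, rfl, rfl⟩ := colored_death_iff.1 h
  obtain ⟨L', R', x', hL, hR, hU, rfl⟩ := colored_death_iff.1 h'
  obtain ⟨rfl, h⟩ := List.append_inj hU (by simpa using (congrArg List.length hL).symm)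
  simp_all

theorem Colored.cross_unique {X : Type*} [Biquandle X] {U V V' : List (Bool × X)} {a b o : Bool}
    (h : (Slice.cross l r a b o).Colored Quad.IsBiquandleColored U V)
    (h' : (Slice.cross l r a b o).Colored Quad.IsBiquandleColored U V') : V = V' := by
  obtain ⟨L, R, x, y, z, w, rfl, rfl, rfl, rfl, hP⟩ := colored_cross_iff.1 h
  obtain ⟨L', R', x', y', z', w', hL, hR, hU, rfl, hP'⟩ := colored_cross_iff.1 h'
  obtain ⟨rfl, h⟩ := List.append_inj hU (by simpa using (congrArg List.length hL).symm)
  simp only [List.cons.injEq, Prod.mk.injEq, true_and] at h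
  obtain ⟨rfl, rfl, rfl⟩ := h
  obtain ⟨rfl, rfl⟩ := Quad.eq_of_isBiquandleColored hP hP'
  rfl

end Iff

/-- The rows `u` color the stack of strips `L`. -/
def StackColored {α : Type*} (P : Quad α → Prop) (L : List Slice) (u : ℕ → List (Bool × α)) :
    Prop :=
  ∀ i (s : Slice), L[i]? = some s → s.Colored P (u i) (u (i + 1))

/-- The stack of strips `L` can be colored with prescribed first and last row. -/
def Colorable {α : Type*} (P : Quad α → Prop) :
    List Slice → List (Bool × α) → List (Bool × α) → Prop
  | [], U, V => U = V
  | s :: L, U, V => ∃ W, s.Colored P U W ∧ Colorable P L W V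

theorem Colorable.exists_rows {α : Type*} {P : Quad α → Prop} {L : List Slice}
    {U V : List (Bool × α)} (h : Colorable P L U V) :
    ∃ m : ℕ → List (Bool × α), m 0 = U ∧ m L.length = V ∧ StackColored P L m := by
  induction L generalizing U with
  | nil => exact ⟨fun _ => U, rfl, h, fun i s hs => by simp at hs⟩
  | cons t L ih =>
    obtain ⟨W, hW, h⟩ := h
    obtain ⟨m, rfl, hV, hm⟩ := ih h
    refine ⟨fun i => i.casesOn U m, rfl, hV, fun i s hs => ?_⟩
    cases i with
    | zero =>
      obtain rfl : t = s := by simpa using hs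
      exact hW
    | succ i => exact hm i s hs

/-- Colorings of the blocks `φ s` with prescribed boundary rows are glued into a coloring of the
whole stack. -/
theorem exists_rows_flatMap {α : Type*} {P : Quad α → Prop} {φ : Slice → List Slice}
    {L : List Slice} {d : ℕ → List (Bool × α)} (h0 : ∀ j, L.length ≤ j → d j = [])
    (h : ∀ j s, L[j]? = some s → Colorable P (φ s) (d j) (d (j + 1))) :
    ∃ u : ℕ → List (Bool × α), (∀ j, u ((L.take j).flatMap φ).length = d j) ∧
      (∀ i, (L.flatMap φ).length ≤ i → u i = []) ∧ StackColored P (L.flatMap φ) u := by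
  induction L generalizing d with
  | nil => exact ⟨fun _ => [], fun j => by simp [h0], fun _ _ => rfl, fun i s hs => by simp at hs⟩
  | cons s L ih =>
    obtain ⟨u, hu, hu0, hc⟩ := ih (d := fun j => d (j + 1))
      (fun j hj => h0 _ (by simpa using hj)) fun j t ht => h (j + 1) t (by simpa using ht)
    obtain ⟨m, hm0, hm1, hm⟩ := (h 0 s rfl).exists_rows
    have hu1 : u 0 = d 1 := by simpa using hu 0
    refine ⟨fun i => if i < (φ s).length then m i else u (i - (φ s).length), fun j => ?_,
      fun i hi => ?_, fun i t ht => ?_⟩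
    · cases j with
      | zero =>
        by_cases hs : 0 < (φ s).length
        · simp [hs, hm0]
        -- An empty block has equal first and last rows, so the rows of the remaining stack may be
        -- used from the start.
        · have hs : (φ s).length = 0 := by omega
          rw [hs, hm0] at hm1
          simp [hs, hu1, hm1]
      | succ j =>
        rw [List.take_succ_cons, List.flatMap_cons, List.length_append, ← hu]
        simp
    · simp only [List.flatMap_cons, List.length_append] at hi
      simp [show ¬ i < (φ s).length by omega, hu0 _ (show _ ≤ i - (φ s).length by omega)]
    · rw [List.flatMap_cons, List.getElem?_append] at ht
      split_ifs at ht with hi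
      · have := hm i t ht
        by_cases hi' : i + 1 < (φ s).length
        · simpa [hi, hi'] using this
        · have e : i + 1 = (φ s).length := by omega
          rw [e, hm1] at this
          simpa [hi, e, hu1] using this
      · have := hc _ t ht
        simpa [hi, show ¬ i + 1 < (φ s).length by omega,
          show i + 1 - (φ s).length = i - (φ s).length + 1 by omega] using this

theorem rows_flatMap_unique {α : Type*} {P : Quad α → Prop} {φ : Slice → List Slice}
    (hφ : ∀ s (m m' : ℕ → List (Bool × α)), StackColored P (φ s) m → StackColored P (φ s) m' →
      m 0 = m' 0 → m (φ s).length = m' (φ s).length → ∀ i ≤ (φ s).length, m i = m' i)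
    {L : List Slice} {u u' : ℕ → List (Bool × α)} (hu : StackColored P (L.flatMap φ) u)
    (hu' : StackColored P (L.flatMap φ) u')
    (h : ∀ j ≤ L.length, u ((L.take j).flatMap φ).length = u' ((L.take j).flatMap φ).length)
    (i : ℕ) (hi : i ≤ (L.flatMap φ).length) : u i = u' i := by
  induction L generalizing u u' i with
  | nil =>
    obtain rfl : i = 0 := by simpa using hi
    simpa using h 0
  | cons s L ih =>
    rw [List.flatMap_cons, List.length_append] at hi
    have h0 : u 0 = u' 0 := by simpa using h 0
    have h1 : u (φ s).length = u' (φ s).length := by simpa using h 1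
    have left {u : ℕ → List (Bool × α)} (hu : StackColored P ((s :: L).flatMap φ) u) :
        StackColored P (φ s) u := fun i t ht => by
      have hi : i < (φ s).length := (List.getElem?_eq_some_iff.1 ht).1
      exact hu i t (by rw [List.flatMap_cons, List.getElem?_append_left hi, ht])
    have right {u : ℕ → List (Bool × α)} (hu : StackColored P ((s :: L).flatMap φ) u) :
        StackColored P (L.flatMap φ) fun i => u ((φ s).length + i) := fun i t ht => by
      refine hu _ t ?_
      rw [List.flatMap_cons, List.getElem?_append_right (by simp)]
      simpa using ht
    by_cases hi' : i ≤ (φ s).length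
    · exact hφ s u u' (left hu) (left hu') h0 h1 i hi'
    · obtain ⟨i, rfl⟩ := Nat.exists_eq_add_of_le (not_le.1 hi').le
      refine ih (right hu) (right hu') (fun j hj => ?_) i (by omega)
      simpa using h (j + 1) (by simpa using hj)

/-- The interior row of a doubled maximum is found from below, that of a doubled minimum from above.
At a doubled crossing the colors propagate downward through the four crossings. -/
theorem double_rows_unique {X : Type*} [Biquandle X] (s : Slice) (m m' : ℕ → List (Bool × X))
    (h : StackColored Quad.IsBiquandleColored s.double m)
    (h' : StackColored Quad.IsBiquandleColored s.double m') (h0 : m 0 = m' 0)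
    (h1 : m s.double.length = m' s.double.length) (i : ℕ) (hi : i ≤ s.double.length) :
    m i = m' i := by
  cases s with
  | birth l r d =>
    have e := (h 1 _ rfl).birth_unique (h1 ▸ h' 1 _ rfl)
    simp only [double, List.length_cons, List.length_nil] at hi
    interval_cases i
    exacts [h0, e, h1]
  | death l r d =>
    have e := (h 0 _ rfl).death_unique (h0 ▸ h' 0 _ rfl)
    simp only [double, List.length_cons, List.length_nil] at hi
    interval_cases i
    exacts [h0, e, h1]
  | cross l r a b o =>
    have e1 := (h 0 _ rfl).cross_unique (h0 ▸ h' 0 _ rfl)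
    have e2 := (h 1 _ rfl).cross_unique (e1 ▸ h' 1 _ rfl)
    have e3 := (h 2 _ rfl).cross_unique (e2 ▸ h' 2 _ rfl)
    simp only [double, List.length_cons, List.length_nil] at hi
    interval_cases i
    exacts [h0, e1, e2, e3, h1]

theorem besideMirror_rows_unique {X : Type*} [Biquandle X] (s : Slice)
    (m m' : ℕ → List (Bool × X))
    (h : StackColored Quad.IsBiquandleColored s.besideMirror m)
    (h' : StackColored Quad.IsBiquandleColored s.besideMirror m') (h0 : m 0 = m' 0)
    (h1 : m s.besideMirror.length = m' s.besideMirror.length) (i : ℕ)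
    (hi : i ≤ s.besideMirror.length) : m i = m' i := by
  have e : m 1 = m' 1 := by
    cases s with
    | birth l r d => exact (h 1 _ rfl).birth_unique (h1 ▸ h' 1 _ rfl)
    | death l r d => exact (h 0 _ rfl).death_unique (h0 ▸ h' 0 _ rfl)
    | cross l r a b o => exact (h 0 _ rfl).cross_unique (h0 ▸ h' 0 _ rfl)
  simp only [besideMirror, List.length_cons, List.length_nil] at hi
  interval_cases i
  exacts [h0, e, h1]

end Slice

/-! ### Colors of the doubled diagram and of the mirror image -/

open Biquandle

/-- The doubled row of colors. -/
def doubleColors {X : Type*} (u : List (Bool × DerivedQuandle X)) : List (Bool × X) :=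
  u.flatMap fun s => [(true, s.2.toBase), (false, s.2.toBase)]

theorem map_fst_doubleColors {X : Type*} (u : List (Bool × DerivedQuandle X)) :
    (doubleColors u).map Prod.fst = doubleRow (u.map Prod.fst) := by
  simp [doubleColors, doubleRow, List.map_flatMap, List.flatMap_map]

theorem Biquandle.star_eq_iff {X : Type*} [Biquandle X] {x y z : X} :
    star x y = z ↔ underOp x y = overOp z y :=
  ⟨fun h => by rw [← h, over_star], fun h => over_cancel y (by rw [over_star, h])⟩

/-- Of the four crossings, the first defines `p, q` from the upper colors and the last defines `s,
t` from the lower ones. What the two middle ones then require is at most `underOp x y = overOp (star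
x y) y`, which is why the derived operation appears. -/
theorem Quad.double_cross {X : Type*} [Biquandle X] {a b o : Bool} {x y z w : DerivedQuandle X}
    (h : (Quad.ofEnds a b o x y z w).IsQuandleColored) : ∃ p q s t : X,
      (Quad.ofEnds false true (doubleOver o (!a) b) x.toBase y.toBase p q).IsBiquandleColored ∧
      (Quad.ofEnds true true (doubleOver o a b) x.toBase p z.toBase s).IsBiquandleColored ∧
      (Quad.ofEnds false false (doubleOver o (!a) (!b)) q y.toBase t w.toBase).IsBiquandleColored ∧
      (Quad.ofEnds true false (doubleOver o a (!b)) s t z.toBase w.toBase).IsBiquandleColored := by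
  have key {x y z : DerivedQuandle X} (h : Shelf.act y x = z) :
      underOp x.toBase y.toBase = overOp z.toBase y.toBase := star_eq_iff.1 h
  cases a <;> cases b <;> cases o <;>
    simp only [Quad.IsQuandleColored, Quad.ofEnds, if_true, if_false, Bool.false_eq_true] at h <;>
    obtain ⟨h, rfl⟩ := h <;>
    simp only [Quad.IsBiquandleColored, Quad.ofEnds, doubleOver, Bool.not_true, Bool.not_false,
      if_true, if_false, Bool.false_eq_true] <;>
    refine ⟨_, _, _, _, ⟨rfl, rfl⟩, ⟨?_, ?_⟩, ⟨?_, ?_⟩, ⟨rfl, rfl⟩⟩ <;>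
    first
    | rfl
    | exact key h
    | exact (key h).symm

theorem Slice.Colored.double {X : Type*} [Biquandle X] {s : Slice}
    {U V : List (Bool × DerivedQuandle X)} (h : s.Colored Quad.IsQuandleColored U V) :
    Colorable Quad.IsBiquandleColored s.double (doubleColors U) (doubleColors V) := by
  cases h with
  | birth L R d x =>
    refine ⟨_, colored_birth_iff.2 ⟨doubleColors L, doubleColors R, x.toBase,
      map_fst_doubleColors L, map_fst_doubleColors R, ?_, rfl⟩, _,
      colored_birth_iff.2 ⟨doubleColors L ++ [(true, x.toBase)],
        (false, x.toBase) :: doubleColors R, x.toBase, ?_, ?_, ?_, rfl⟩, ?_⟩ <;>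
      first
      | simp [map_fst_doubleColors]; done
      | simp [doubleColors, Colorable]
  | death L R d x =>
    refine ⟨doubleColors L ++ (true, x.toBase) :: (false, x.toBase) :: doubleColors R,
      colored_death_iff.2 ⟨doubleColors L ++ [(true, x.toBase)],
        (false, x.toBase) :: doubleColors R, x.toBase, ?_, ?_, ?_, ?_⟩, _,
      colored_death_iff.2 ⟨doubleColors L, doubleColors R, x.toBase,
      map_fst_doubleColors L, map_fst_doubleColors R, rfl, rfl⟩, ?_⟩ <;>
      first
      | simp [map_fst_doubleColors]; done
      | simp [doubleColors, Colorable]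
  | cross L R a b o x y z w h =>
    obtain ⟨p, q, s, t, h1, h2, h3, h4⟩ := Quad.double_cross h
    refine ⟨doubleColors L ++ (true, x.toBase) :: (true, p) :: (false, q) :: (false, y.toBase) ::
        doubleColors R,
      colored_cross_iff.2 ⟨doubleColors L ++ [(true, x.toBase)],
        (false, y.toBase) :: doubleColors R, _, _, _, _, ?_, ?_, ?_, ?_, h1⟩,
      doubleColors L ++ (true, z.toBase) :: (true, s) :: (false, q) :: (false, y.toBase) ::
        doubleColors R,
      colored_cross_iff.2 ⟨doubleColors L, (false, q) :: (false, y.toBase) :: doubleColors R,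
        _, _, _, _, ?_, ?_, ?_, ?_, h2⟩,
      doubleColors L ++ (true, z.toBase) :: (true, s) :: (false, t) :: (false, w.toBase) ::
        doubleColors R,
      colored_cross_iff.2 ⟨doubleColors L ++ [(true, z.toBase), (true, s)], doubleColors R,
        _, _, _, _, ?_, ?_, ?_, ?_, h3⟩, _,
      colored_cross_iff.2 ⟨doubleColors L ++ [(true, z.toBase)],
        (false, w.toBase) :: doubleColors R, _, _, _, _, ?_, ?_, ?_, rfl, h4⟩, ?_⟩ <;>
      first
      | simp [map_fst_doubleColors]; done
      | simp [doubleColors, Colorable]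

/-- The colors of the mirror image of a row with the opposite orientation. -/
def mirrorColors {X : Type*} (u : List (Bool × X)) : List (Bool × X) :=
  (u.map fun s => (!s.1, s.2)).reverse

theorem map_fst_mirrorColors {X : Type*} (u : List (Bool × X)) :
    (mirrorColors u).map Prod.fst = mirrorRow (u.map Prod.fst) := by
  simp [mirrorColors, mirrorRow, Function.comp_def]

/-- A reflection exchanges left and right of a string and reversal exchanges them back, so the
specified region is kept. The under and over strings are kept as well: `o` is negated only because
the string from top left has become the one from top right. -/
theorem Quad.ofEnds_mirror {α : Type*} (a b o : Bool) (x y z w : α) :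
    Quad.ofEnds (!b) (!a) (!o) y x w z = Quad.ofEnds a b o x y z w := by
  cases a <;> cases b <;> cases o <;> rfl

theorem Slice.Colored.besideMirror {X : Type*} [Biquandle X] {s : Slice}
    {U V : List (Bool × X)} (h : s.Colored Quad.IsBiquandleColored U V) :
    Colorable Quad.IsBiquandleColored s.besideMirror (U ++ mirrorColors U)
      (V ++ mirrorColors V) := by
  -- The strip is passed before its mirror image, so in between the left part is already `V` and the
  -- right part still comes from `U`.
  refine ⟨V ++ mirrorColors U, ?_, V ++ mirrorColors V, ?_, rfl⟩
  · cases h with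
    | birth L R d x =>
      exact colored_birth_iff.2 ⟨L, R ++ mirrorColors (L ++ R), x, by simp,
        by simp [map_fst_mirrorColors, top], by simp, by simp⟩
    | death L R d x =>
      exact colored_death_iff.2 ⟨L, R ++ mirrorColors (L ++ (d, x) :: (!d, x) :: R), x, by simp,
        by simp [map_fst_mirrorColors, top], by simp, by simp⟩
    | cross L R a b o x y z w h =>
      exact colored_cross_iff.2 ⟨L, R ++ mirrorColors (L ++ (a, x) :: (b, y) :: R), x, y, z, w,
        by simp, by simp [map_fst_mirrorColors, top], by simp, by simp, h⟩
  · have e := h.map_fst.2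
    cases h with
    | birth L R d x =>
      refine colored_birth_iff.2 ⟨L ++ (d, x) :: (!d, x) :: R ++ mirrorColors R, mirrorColors L, x,
        ?_, map_fst_mirrorColors L, ?_, ?_⟩
      · rw [List.map_append, e, map_fst_mirrorColors]
      all_goals simp [mirrorColors]
    | death L R d x =>
      refine colored_death_iff.2 ⟨L ++ R ++ mirrorColors R, mirrorColors L, x,
        ?_, map_fst_mirrorColors L, ?_, ?_⟩
      · rw [List.map_append, e, map_fst_mirrorColors]
      all_goals simp [mirrorColors]
    | cross L R a b o x y z w h =>
      refine colored_cross_iff.2 ⟨L ++ (b, z) :: (a, w) :: R ++ mirrorColors R, mirrorColors L,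
        y, x, w, z, ?_, map_fst_mirrorColors L, ?_, ?_, ?_⟩
      · rw [List.map_append, e, map_fst_mirrorColors]
      · simp [mirrorColors]
      · simp [mirrorColors]
      · rwa [Quad.ofEnds_mirror]

/-! ### Pulling the copies away -/

section PullAway

variable {X : Type*} [Biquandle X]

/-- The doubled row with the colors transformed by `f`. -/
def strands (f : starAut X) (u : List (Bool × DerivedQuandle X)) : List (Strand X) :=
  u.flatMap fun s => [⟨s.1, true, f • s.2.toBase⟩, ⟨!s.1, false, f • s.2.toBase⟩]

theorem strands_one (u : List (Bool × DerivedQuandle X)) :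
    List.zipWith (fun f s => (⟨f, s.1, s.2⟩ : Strand X)) (frontTags (u.map Prod.fst))
      (doubleColors u) = strands 1 u := by
  induction u with
  | nil => rfl
  | cons s u ih =>
    simp only [frontTags, doubleColors, strands, List.map_cons, List.flatMap_cons,
      List.cons_append, List.nil_append, List.zipWith_cons_cons, one_smul] at ih ⊢
    rw [ih]

/-- Passing under a downward string of color `c` changes the moving color to `underOp x c`, and the
upward partner of the same color changes it back to `x`. Both members of the pair become `overOp c
x`. -/
theorem slide_false (x : X) (f : starAut X) (u) :
    Slide false x (strands f u) (strands (overAut x * f) u) x := by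
  induction u with
  | nil => exact .nil x
  | cons s u ih =>
    refine .cons x (underOp x (f • s.2.toBase)) x _ _ _ _ ⟨rfl, ?_⟩
      (.cons _ x x _ _ _ _ ⟨rfl, ?_⟩ ih) <;> simp [Quad.ofEnds, mul_smul]

theorem slide_true (x : X) (f : starAut X) (u) :
    Slide true x (strands f u) (strands ((overAut x)⁻¹ * f) u) x := by
  induction u with
  | nil => exact .nil x
  | cons s u ih =>
    refine .cons x (underOp x (overInv (f • s.2.toBase) x)) x _ _ _ _ ⟨?_, ?_⟩
      (.cons _ x x _ _ _ _ ⟨?_, ?_⟩ ih) <;> simp [Quad.ofEnds, mul_smul, over_overInv]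

/-- Removing the copy of the first string changes the state of the remaining row by the `step` of
that string, so the induction runs along `psiRow`. Each copy is placed to the left of the earlier
ones, which makes the back row the mirror image. -/
theorem pullAway_strands (f : starAut X) (u) :
    PullAway (strands f u) (psiRow f u) (mirrorColors (psiRow f u)) := by
  induction u generalizing f with
  | nil => exact .nil
  | cons s u ih =>
    obtain ⟨_ | _, b⟩ := s
    -- The copy of an upward string lies on its left and first passes under its own original. Both
    -- strings then have the color `k (f • b)`, by `under_self`; this is where `k` enters.
    · have := PullAway.back true (f • b.toBase) (k (f • b.toBase))
        (⟨true, false, f • b.toBase⟩ :: strands f u) _ _ _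
        (.cons _ (k (f • b.toBase)) _ _ (k (f • b.toBase)) _ _
          ⟨by simp [Quad.ofEnds, under_self, over_k_k], by simp [Quad.ofEnds, over_k_k]⟩
          (slide_true (k (f • b.toBase)) f u))
        (.front false (k (f • b.toBase)) _ _ _ (ih _))
      simpa [strands, mirrorColors, psiRow, step] using this
    · have := PullAway.front true (f • b.toBase) _ _ _
        (.back false (f • b.toBase) _ _ _ _ _ (slide_false (f • b.toBase) f u) (ih _))
      simpa [strands, mirrorColors, psiRow, step] using this

theorem Slide.unique {d : Bool} {x y y' : X} {u v v' : List (Strand X)} (h : Slide d x u v y)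
    (h' : Slide d x u v' y') : v = v' ∧ y = y' := by
  induction h generalizing v' with
  | nil x =>
    cases h'
    exact ⟨rfl, rfl⟩
  | cons x x' y t c u u' hq _ ih =>
    cases h' with
    | cons _ x'' _ _ c' _ u'' hq' h' =>
    obtain ⟨rfl, rfl⟩ := Quad.eq_of_isBiquandleColored hq hq'
    obtain ⟨rfl, rfl⟩ := ih h'
    exact ⟨rfl, rfl⟩

theorem PullAway.unique {u : List (Strand X)} {F B F' B' : List (Bool × X)}
    (h : PullAway u F B) (h' : PullAway u F' B') : F = F' ∧ B = B' := by
  induction h generalizing F' B' with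
  | nil =>
    cases h'
    exact ⟨rfl, rfl⟩
  | front d x u F B _ ih =>
    cases h' with
    | front _ _ _ _ _ h' =>
    obtain ⟨rfl, rfl⟩ := ih h'
    exact ⟨rfl, rfl⟩
  | back d x y u v F B hs _ ih =>
    cases h' with
    | back _ _ _ _ _ _ _ hs' h' =>
    obtain ⟨rfl, rfl⟩ := hs.unique hs'
    obtain ⟨rfl, rfl⟩ := ih h'
    exact ⟨rfl, rfl⟩

end PullAway

/-! ### The descriptions of `Ψ` and the conclusion -/

namespace LinkDiagram

variable {D : LinkDiagram} {X : Type*} [Biquandle X]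

theorem length_flatMap_besideMirror (L : List Slice) :
    (L.flatMap Slice.besideMirror).length = 2 * L.length := by
  induction L with
  | nil => rfl
  | cons s L ih =>
    rw [List.flatMap_cons, List.length_append, ih]
    simp [Slice.besideMirror]
    omega

theorem exists_isDoubled (C : D.QuandleColoring (DerivedQuandle X)) :
    ∃ C₁ : D.double.BiquandleColoring X, IsDoubled C C₁ := by
  obtain ⟨u, hu, h0, h⟩ := Slice.exists_rows_flatMap (L := D.slices) (φ := Slice.double)
    (d := fun j => doubleColors (C.row j)) (P := Quad.IsBiquandleColored)
    (fun j hj => by rw [C.row_eq_nil hj]; rfl) fun j s hs => (C.row_colored hs).double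
  obtain ⟨C₁, hC₁⟩ := BiquandleColoring.exists_row_eq (D := D.double) u h0 h
  exact ⟨C₁, fun j => (hC₁ _).trans (hu j)⟩

theorem IsDoubled.unique {C : D.QuandleColoring (DerivedQuandle X)}
    {C₁ C₂ : D.double.BiquandleColoring X} (h₁ : IsDoubled C C₁) (h₂ : IsDoubled C C₂) :
    C₁ = C₂ := by
  refine BiquandleColoring.ext_row fun i => ?_
  by_cases hi : i ≤ D.double.slices.length
  · exact Slice.rows_flatMap_unique (P := Quad.IsBiquandleColored) Slice.double_rows_unique
      (L := D.slices) (u := C₁.row) (u' := C₂.row)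
      (fun i s hs => C₁.row_colored hs) (fun i s hs => C₂.row_colored hs)
      (fun j _ => (h₁ j).trans (h₂ j).symm) i hi
  · rw [C₁.row_eq_nil (not_le.1 hi).le, C₂.row_eq_nil (not_le.1 hi).le]

theorem exists_besideMirror_row_eq (C : D.BiquandleColoring X) :
    ∃ C₂ : D.besideMirror.BiquandleColoring X,
      ∀ j, C₂.row (2 * j) = C.row j ++ mirrorColors (C.row j) := by
  obtain ⟨u, hu, h0, h⟩ := Slice.exists_rows_flatMap (L := D.slices) (φ := Slice.besideMirror)
    (d := fun j => C.row j ++ mirrorColors (C.row j)) (P := Quad.IsBiquandleColored)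
    (fun j hj => by rw [C.row_eq_nil hj]; rfl) fun j s hs => (C.row_colored hs).besideMirror
  obtain ⟨C₂, hC₂⟩ := BiquandleColoring.exists_row_eq (D := D.besideMirror) u h0 h
  refine ⟨C₂, fun j => ?_⟩
  by_cases hj : j ≤ D.slices.length
  · rw [hC₂, ← hu j, length_flatMap_besideMirror, List.length_take, min_eq_left hj]
  · rw [C.row_eq_nil (not_le.1 hj).le, C₂.row_eq_nil]
    · rfl
    · change (D.slices.flatMap _).length ≤ _
      rw [length_flatMap_besideMirror]
      omega

/-- Only the even lines come from lines of `D`; the line inside each block is determined by its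
neighbors. -/
theorem besideMirror_ext {C C' : D.besideMirror.BiquandleColoring X}
    (h : ∀ j, C.row (2 * j) = C'.row (2 * j)) : C = C' := by
  refine BiquandleColoring.ext_row fun i => ?_
  by_cases hi : i ≤ D.besideMirror.slices.length
  · refine Slice.rows_flatMap_unique (P := Quad.IsBiquandleColored)
      Slice.besideMirror_rows_unique (L := D.slices) (u := C.row) (u' := C'.row)
      (fun i s hs => C.row_colored hs) (fun i s hs => C'.row_colored hs)
      (fun j _ => ?_) i hi
    rw [length_flatMap_besideMirror]
    exact h _
  · rw [C.row_eq_nil (not_le.1 hi).le, C'.row_eq_nil (not_le.1 hi).le]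

theorem exists_double_pullAway_restrict {C : D.QuandleColoring (DerivedQuandle X)}
    {C' : D.BiquandleColoring X} (h : ∀ j, C'.row j = psiRow 1 (C.row j)) :
    ∃ (C₁ : D.double.BiquandleColoring X) (C₂ : D.besideMirror.BiquandleColoring X),
      (IsDoubled C C₁ ∧ ∀ C', IsDoubled C C' → C' = C₁) ∧
      (IsPulledAway C₁ C₂ ∧ ∀ C', IsPulledAway C₁ C' → C' = C₂) ∧ IsRestriction C₂ C' := by
  obtain ⟨C₁, h₁⟩ := exists_isDoubled C
  obtain ⟨C₂, h₂⟩ := exists_besideMirror_row_eq C'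
  have hp (j : ℕ) : PullAway (List.zipWith (fun f s => (⟨f, s.1, s.2⟩ : Strand X))
      (frontTags (D.row j)) (C₁.row (D.doubleLevel j))) (C'.row j) (mirrorColors (C'.row j)) := by
    have e : D.row j = (C.row j).map Prod.fst := (map_fst_coloredRow _ j).symm
    rw [h₁ j, e, h j]
    exact strands_one (C.row j) ▸ pullAway_strands 1 (C.row j)
  refine ⟨C₁, C₂, ⟨h₁, fun _ h' => h'.unique h₁⟩, ⟨fun j => ⟨_, _, hp j, h₂ j⟩, fun C₃ h₃ => ?_⟩,
    fun j => ?_⟩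
  · refine besideMirror_ext fun j => ?_
    obtain ⟨F, B, hFB, e⟩ := h₃ j
    obtain ⟨rfl, rfl⟩ := hFB.unique (hp j)
    rw [e, h₂]
  · have e : (C'.row j).length = (D.row j).length := length_coloredRow _ j
    rw [h₂, ← e, List.take_left]

end LinkDiagram

open LinkDiagram

theorem theorem3p1 {X : Type*} [Biquandle X] (D : LinkDiagram) :
    ∃ (Ψ : D.QuandleColoring (DerivedQuandle X) → D.BiquandleColoring X)
      (Φ : D.BiquandleColoring X → D.QuandleColoring (DerivedQuandle X)),
      -- the two maps are mutually inverse
      Function.LeftInverse Φ Ψ ∧ Function.RightInverse Φ Ψ ∧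
      -- the map `Ψ` is: double, pull away, restrict
      (∀ C : D.QuandleColoring (DerivedQuandle X),
        ∃ (C₁ : D.double.BiquandleColoring X) (C₂ : D.besideMirror.BiquandleColoring X),
          (LinkDiagram.IsDoubled C C₁ ∧ ∀ C', LinkDiagram.IsDoubled C C' → C' = C₁) ∧
          (LinkDiagram.IsPulledAway C₁ C₂ ∧ ∀ C', LinkDiagram.IsPulledAway C₁ C' → C' = C₂) ∧
          LinkDiagram.IsRestriction C₂ (Ψ C)) ∧
      -- the map `Φ` is: push out to the unbounded region, along any arc
      (∀ (C : D.BiquandleColoring X) (p : D.Point),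
        (∃ γ, D.Path γ (D.specified p)) ∧
        ∀ γ, D.Path γ (D.specified p) → ∀ a : X,
          LinkDiagram.PushOut C γ (C.toFun (D.semiArc p)) a ↔
            ((Φ C).toFun (D.arc p)).toBase = a) ∧
      -- the map `Ψ` is the composite of the shadow coloring with `ψ`
      (∃ ψ : AssocGroup (DerivedQuandle X) → DerivedQuandle X → X,
        IsPsi ψ ∧ (∀ ψ', IsPsi ψ' → ψ' = ψ) ∧
        ∀ C : D.QuandleColoring (DerivedQuandle X),
          ∃ R : D.Region → AssocGroup (DerivedQuandle X),
            LinkDiagram.IsRegionColoring C R ∧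
            (∀ R', LinkDiagram.IsRegionColoring C R' → R' = R) ∧
            ∀ p : D.Point,
              (Ψ C).toFun (D.semiArc p) = ψ (R (D.specified p)) (C.toFun (D.arc p))) := by
  -- Both maps translate every row from the state `1` of the unbounded region.
  choose Ψ hΨ using exists_row_eq_psiRow (D := D) (X := X)
  choose Φ hΦ using exists_row_eq_phiRow (D := D) (X := X)
  refine ⟨Ψ, Φ, fun C => ?_, fun C => ?_, fun C => exists_double_pullAway_restrict (hΨ C),
    fun C p => ⟨exists_path _, fun γ hγ a => ?_⟩, psi, isPsi_psi, fun _ h => h.eq isPsi_psi,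
    fun C => ?_⟩
  · exact QuandleColoring.ext_row fun j => by rw [hΦ, hΨ, phiRow_psiRow]
  · exact BiquandleColoring.ext_row fun j => by rw [hΨ, hΦ, psiRow_phiRow]
  · obtain ⟨S, h0, hS, hS'⟩ := exists_state_region C
    rw [pushOut_iff h0 hS hγ, toBase_eq_of_row_eq (hΦ C) hS']
  · obtain ⟨R, hR, hR'⟩ := exists_isRegionColoring C
    exact ⟨R, hR, fun _ h => h.eq hR, eq_psi_of_row_eq (hΨ C) hR'⟩
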